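/- For integers $0\le m,n\le N$ let $\mathrm{Hyp}(m,n,N)$ be the law of the number $W$ of balls in the first $n$ of $N$ urns when $m$ balls are placed uniformly at random into the $N$ urns, at most one ball per urn, i.e. $\mathbb P[W=k]=\binom nk\binom{N-n}{m-k}/\binom Nm$. For $\mu\in\mathbb R$ and $\sigma^2\ge 0$ put $\gamma=(\mu-\sigma^2)-\lfloor\mu-\sigma^2\rfloor$ and let $\mathrm{TP}(\mu,\sigma^2)$ be the law of $Y$ when $Y-\mu+\sigma^2+\gamma\sim\mathrm{Po}(\sigma^2+\gamma)$. For probability distributions $P,Q$ on $\mathbb Z$ let $d_{\mathrm{TV}}(P,Q)=\sup_{A\subset\mathbb Z}|P(A)-Q(A)|$ and $d_{\mathrm{loc}}(P,Q)=\sup_{k\in\mathbb Z}|P\{k\}-Q\{k\}|$. **Theorem 4.2.** (i) Let $0<m<N$, $0<n<N$, and let $\mu$ and $\sigma^2$ be the mean and the variance of $\mathrm{Hyp}(m,n,N)$. Then $$\sigma^2=\frac{nm(N-n)(N-m)}{(N-1)N^2}.$$ Put $\lambda=\frac{N}{m(N-m+1)}$; then $\lambda>0$, and $\lambda<1$ if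 $m\ge2$. There is an exchangeable pair $(W,W')$ of integer valued random variables with $\mathcal L(W)=\mathrm{Hyp}(m,n,N)$ such that, almost surely, $$\mathbb E[W'-\mu\mid W]=(1-\lambda)(W-\mu)\quad\text{and}\quad W'-W\in\{-1,0,1\},$$ and such that, with $S=\mathbb P[W'=W+1\mid W]$ and $q_{\max}=\max_{k\in\mathbb Z}\mathbb P[W=k]$, $$d_{\mathrm{TV}}(\mathcal L(W),\mathrm{TP}(\mu,\sigma^2))\le\frac{\sqrt{\operatorname{Var}S}}{\lambda\sigma^2}+\frac{2}{\sigma^2},\qquad d_{\mathrm{loc}}(\mathcal L(W),\mathrm{TP}(\mu,\sigma^2))\le\frac{2\sqrt{q_{\max}\operatorname{Var}S}}{\lambda\sigma^2}+\frac{2}{\sigma^2},$$ $$\operatorname{Var}S\le\frac{nm(m+n)^2(N-n)(N-m)}{m^2(N-m+1)^2(N-1)N^2}.$$ (ii) Let $N=N(n)$ and $m=m(n)$ be integers with $n\le N$, $0\le m\le N$ for all large $n$, and suppose that $N\asymp n$, $m\asymp n$ and $\sigma^2\asymp n$ as $n\to\infty$, where $\mu=\mu(n)$ and $\sigma^2=\sigma^2(n)$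 are the mean and the variance of $\mathrm{Hyp}(m,n,N)$. Then, as $n\to\infty$, $$d_{\mathrm{TV}}(\mathrm{Hyp}(m,n,N),\mathrm{TP}(\mu,\sigma^2))=O(n^{-1/2}),\qquad d_{\mathrm{loc}}(\mathrm{Hyp}(m,n,N),\mathrm{TP}(\mu,\sigma^2))=O(n^{-1}).$$ -/

import Mathlib

open MeasureTheory ProbabilityTheory Filter Asymptotics

noncomputable section

/-- The hypergeometric distribution `Hyp(m, n, N)` as a measure on `ℤ` (for `m, n ≤ N`): the law of
the number of balls in the first `n` of `N` urns, when `m` balls are put uniformly at random into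
the `N` urns, at most one ball per urn. Its point probabilities are
`C(n, k) C(N - n, m - k) / C(N, m)`. -/
def hypergeometric (m n N : ℕ) : Measure ℤ :=
  ∑ k ∈ Finset.range (m + 1),
    ENNReal.ofReal ((n.choose k : ℝ) * ((N - n).choose (m - k) : ℝ) / (N.choose m : ℝ)) •
      Measure.dirac (k : ℤ)

/-- The mean of a distribution on `ℤ`. -/
def lawMean (ν : Measure ℤ) : ℝ := ∫ k, (k : ℝ) ∂ν

/-- The variance of a distribution on `ℤ`. -/
def lawVar (ν : Measure ℤ) : ℝ := Var[fun k : ℤ => (k : ℝ); ν]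

/-- The translated Poisson distribution `TP(μ, v)`, `v ≥ 0`: with `γ = fract (μ - v)`, it is the law
of `Y` where `Y - μ + v + γ` is `Po(v + γ)`-distributed; note `μ - v - γ = ⌊μ - v⌋`. -/
def translatedPoisson (μ v : ℝ) : Measure ℤ :=
  (poissonMeasure (v + Int.fract (μ - v)).toNNReal).map (fun j : ℕ => (j : ℤ) + ⌊μ - v⌋)

/-- The translated Poisson distribution with the mean of `ν` and variance parameter `Var ν`. -/
def matchingTP (ν : Measure ℤ) : Measure ℤ := translatedPoisson (lawMean ν) (lawVar ν)

/-- Total variation distance `sup_{A ⊆ ℤ} |P(A) - Q(A)|`. -/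
def dTV (P Q : Measure ℤ) : ℝ := ⨆ A : Set ℤ, |P.real A - Q.real A|

/-- Local distance `sup_k |P{k} - Q{k}|`. -/
def dLoc (P Q : Measure ℤ) : ℝ := ⨆ k : ℤ, |P.real {k} - Q.real {k}|

/-- The maximal point probability `max_k P{k}`. -/
def qMax (P : Measure ℤ) : ℝ := ⨆ k : ℤ, P.real {k}

/-- `(W, W')` is an exchangeable pair of integer valued random variables. -/
def IsExchangeablePair {Ω : Type*} [MeasurableSpace Ω] (P : Measure Ω) (W W' : Ω → ℤ) : Prop :=
  Measurable W ∧ Measurable W' ∧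
    P.map (fun ω => (W ω, W' ω)) = P.map (fun ω => (W' ω, W ω))

/-- The linear regression condition `E[W' - μ | W] = (1 - l) (W - μ) + R` (almost surely). -/
def RegressionCondition {Ω : Type*} [MeasurableSpace Ω] (P : Measure Ω) (W W' : Ω → ℤ)
    (μ l : ℝ) (R : Ω → ℝ) : Prop :=
  P[fun ω => (W' ω : ℝ) - μ | MeasurableSpace.comap W inferInstance]
    =ᵐ[P] fun ω => (1 - l) * ((W ω : ℝ) - μ) + R ω

/-- The random variable `S = S(W) = P[W' = W + 1 | W]`. -/
def upProb {Ω : Type*} [MeasurableSpace Ω] (P : Measure Ω) (W W' : Ω → ℤ) : Ω → ℝ :=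
  P[Set.indicator {ω | W' ω = W ω + 1} (fun _ => (1 : ℝ)) |
    MeasurableSpace.comap W inferInstance]

end

/-!
If `(W, W')` is an exchangeable pair of integers with `|W' - W| ≤ 1` and linear regression constant
`λ`, then antisymmetry of the increments turns `λ E[(W - μ) f(W)]` into `E[S (f(W + 1) - f(W))]`,
where `S = P[W' = W + 1 | W]`. Hence `T = S / λ` satisfies a discrete integration by parts formula.
It has mean `σ²`, and inserting the solution of the Stein equation of `TP(μ, σ²)` bounds the
distances by the fluctuations of `T` about `σ²`, up to `2 / σ²` from the lattice correction `γ`.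

For the hypergeometric law the pair comes from moving one random ball. This is a reversible
birth–death chain, for which `T = (m - W)(n - W) / N` and
`T - σ² = (W - μ)(W + μ - m - n) / N - σ² / N`. For the local distance Cauchy–Schwarz only gives
a bound containing `q_max`; the optimal order follows instead from unimodality, which makes
`|k - μ| P[W = k]` and therefore also `|T - σ²| P[W = k]` bounded.
-/

open scoped NNReal

section PoissonSteinEquation

lemma measureReal_inter_Iio_succ (ρ : Measure ℕ) [IsFiniteMeasure ρ] (B : Set ℕ) (j : ℕ) :
    ρ.real (B ∩ Set.Iio (j + 1)) = ρ.real (B ∩ Set.Iio j) + B.indicator 1 j * ρ.real {j} := by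
  rw [← Order.succ_eq_add_one, Order.Iio_succ_eq_insert]
  by_cases h : j ∈ B
  · rw [Set.inter_insert_of_mem h, ← Set.union_singleton,
      measureReal_union (by simp) (measurableSet_singleton j), Set.indicator_of_mem h,
      Pi.one_apply, one_mul]
  · rw [Set.inter_insert_of_notMem h, Set.indicator_of_notMem h, zero_mul, add_zero]

lemma measureReal_Iio_succ (ρ : Measure ℕ) [IsFiniteMeasure ρ] (j : ℕ) :
    ρ.real (Set.Iio (j + 1)) = ρ.real (Set.Iio j) + ρ.real {j} := by
  simpa using measureReal_inter_Iio_succ ρ Set.univ j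

lemma mul_poissonMeasure_real_singleton (r : ℝ≥0) (j : ℕ) :
    r * Po(r).real {j} = (j + 1) * Po(r).real {j + 1} := by
  rw [poissonMeasure_real_singleton, poissonMeasure_real_singleton, Nat.factorial_succ]
  push_cast
  field_simp
  ring

lemma mul_poissonMeasure_real_Iio_le (r : ℝ≥0) (j : ℕ) :
    r * Po(r).real (Set.Iio j) ≤ j * Po(r).real (Set.Iio (j + 1)) := by
  induction j with
  | zero => simp
  | succ j ih =>
    have hstep := mul_poissonMeasure_real_singleton r j
    have hnonneg : 0 ≤ Po(r).real (Set.Iio (j + 1)) := measureReal_nonneg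
    rw [measureReal_Iio_succ _ (j + 1)]
    rw [measureReal_Iio_succ] at ih hnonneg ⊢
    push_cast
    linarith

lemma mul_one_sub_poissonMeasure_real_Iio_le (r : ℝ≥0) (j : ℕ) :
    j * (1 - Po(r).real (Set.Iio (j + 1))) ≤ r * (1 - Po(r).real (Set.Iio j)) := by
  have hasSum_tail (i : ℕ) :
      HasSum (fun k => Po(r).real {k + i}) (1 - Po(r).real (Set.Iio i)) := by
    have h : HasSum (fun k => Po(r).real {k}) 1 := by
      simpa only [poissonMeasure_real_singleton] using hasSum_one_poissonMeasure r
    simpa using (hasSum_nat_add_iff' i).2 h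
  refine hasSum_le (fun k => ?_) ((hasSum_tail (j + 1)).mul_left _) ((hasSum_tail j).mul_left _)
  rw [mul_poissonMeasure_real_singleton, ← add_assoc]
  gcongr
  push_cast
  linarith [Nat.cast_nonneg (α := ℝ) k]

/-- `P[X < j] / (j P[X = j])` for `X ∼ Po(r)`, a coefficient of the Poisson Stein solution; it is
`0` at `j = 0` through division by zero. -/
noncomputable def poissonHeadRatio (r : ℝ≥0) (j : ℕ) : ℝ :=
  Po(r).real (Set.Iio j) / (j * Po(r).real {j})

/-- `P[X ≥ j] / (j P[X = j])` for `X ∼ Po(r)`, a coefficient of the Poisson Stein solution; it is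
`0` at `j = 0` through division by zero. -/
noncomputable def poissonTailRatio (r : ℝ≥0) (j : ℕ) : ℝ :=
  (1 - Po(r).real (Set.Iio j)) / (j * Po(r).real {j})

/-- The solution `f` of the Stein equation `r f(j + 1) - j f(j) = 1_B(j) - Po(r)(B)` with
`f(0) = 0`; the latter comes from division by zero. -/
noncomputable def poissonStein (r : ℝ≥0) (B : Set ℕ) (j : ℕ) : ℝ :=
  (Po(r).real (B ∩ Set.Iio j) - Po(r).real B * Po(r).real (Set.Iio j)) / (j * Po(r).real {j})

lemma poissonHeadRatio_nonneg (r : ℝ≥0) (j : ℕ) : 0 ≤ poissonHeadRatio r j := by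
  unfold poissonHeadRatio
  positivity

lemma poissonTailRatio_nonneg (r : ℝ≥0) (j : ℕ) : 0 ≤ poissonTailRatio r j :=
  div_nonneg (sub_nonneg.2 measureReal_le_one) (by positivity)

lemma poissonStein_zero (r : ℝ≥0) (B : Set ℕ) : poissonStein r B 0 = 0 := by
  simp [poissonStein]

lemma poissonStein_eq_sub (r : ℝ≥0) (B : Set ℕ) (j : ℕ) :
    poissonStein r B j = Po(r).real (B ∩ Set.Iio j) * poissonTailRatio r j -
      (Po(r).real B - Po(r).real (B ∩ Set.Iio j)) * poissonHeadRatio r j := by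
  unfold poissonStein poissonTailRatio poissonHeadRatio
  ring

lemma poissonStein_compl (r : ℝ≥0) (B : Set ℕ) (j : ℕ) :
    poissonStein r Bᶜ j = -poissonStein r B j := by
  have hcompl : Po(r).real Bᶜ = 1 - Po(r).real B := probReal_compl_eq_one_sub .of_discrete
  have hsplit : Po(r).real (B ∩ Set.Iio j) + Po(r).real (Bᶜ ∩ Set.Iio j) =
      Po(r).real (Set.Iio j) := by
    rw [Set.inter_comm, Set.inter_comm Bᶜ, ← Set.sdiff_eq]
    exact measureReal_inter_add_sdiff .of_discrete
  unfold poissonStein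
  rw [hcompl, ← hsplit]
  ring

lemma poissonStein_singleton_of_le (r : ℝ≥0) {t j : ℕ} (h : j ≤ t) :
    poissonStein r {t} j = -(Po(r).real {t} * poissonHeadRatio r j) := by
  have hempty : ({t} : Set ℕ) ∩ Set.Iio j = ∅ := by simp [h]
  rw [poissonStein_eq_sub, hempty, measureReal_empty]
  ring

lemma poissonStein_singleton_of_lt (r : ℝ≥0) {t j : ℕ} (h : t < j) :
    poissonStein r {t} j = Po(r).real {t} * poissonTailRatio r j := by
  have hsingleton : ({t} : Set ℕ) ∩ Set.Iio j = {t} := by simp [h]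
  rw [poissonStein_eq_sub, hsingleton]
  ring

variable {r : ℝ≥0}

lemma mul_poissonStein_succ (hr : 0 < r) (B : Set ℕ) (j : ℕ) :
    r * poissonStein r B (j + 1) =
      (Po(r).real (B ∩ Set.Iio (j + 1)) - Po(r).real B * Po(r).real (Set.Iio (j + 1))) /
        Po(r).real {j} := by
  have hp := poissonMeasure_real_singleton_pos j hr
  unfold poissonStein
  push_cast
  rw [← mul_poissonMeasure_real_singleton]
  field_simp

lemma poissonStein_equation (hr : 0 < r) (B : Set ℕ) (j : ℕ) :
    r * poissonStein r B (j + 1) - j * poissonStein r B j = B.indicator 1 j - Po(r).real B := by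
  have hp := poissonMeasure_real_singleton_pos j hr
  have hmul : j * poissonStein r B j =
      (Po(r).real (B ∩ Set.Iio j) - Po(r).real B * Po(r).real (Set.Iio j)) / Po(r).real {j} := by
    rcases j.eq_zero_or_pos with rfl | hj
    · simp
    · unfold poissonStein
      field_simp
  rw [mul_poissonStein_succ hr, hmul, measureReal_inter_Iio_succ, measureReal_Iio_succ]
  field_simp
  ring

lemma poissonHeadRatio_le_succ (hr : 0 < r) (j : ℕ) :
    poissonHeadRatio r j ≤ poissonHeadRatio r (j + 1) := by
  rcases j.eq_zero_or_pos with rfl | hj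
  · simpa [poissonHeadRatio] using poissonHeadRatio_nonneg r 1
  · have hp := poissonMeasure_real_singleton_pos j hr
    unfold poissonHeadRatio
    push_cast
    rw [← mul_poissonMeasure_real_singleton, div_le_div_iff₀ (by positivity) (by positivity)]
    linarith [mul_le_mul_of_nonneg_right (mul_poissonMeasure_real_Iio_le r j) hp.le]

lemma poissonTailRatio_succ_le (hr : 0 < r) {j : ℕ} (hj : 0 < j) :
    poissonTailRatio r (j + 1) ≤ poissonTailRatio r j := by
  have hp := poissonMeasure_real_singleton_pos j hr
  unfold poissonTailRatio
  push_cast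
  rw [← mul_poissonMeasure_real_singleton, div_le_div_iff₀ (by positivity) (by positivity)]
  linarith [mul_le_mul_of_nonneg_right (mul_one_sub_poissonMeasure_real_Iio_le r j) hp.le]

lemma poissonMeasure_real_singleton_mul_ratio_le (hr : 0 < r) (j : ℕ) :
    Po(r).real {j} * (poissonTailRatio r (j + 1) + poissonHeadRatio r j) ≤ 1 / r := by
  have hp := poissonMeasure_real_singleton_pos j hr
  have hr' : (0 : ℝ) < r := hr
  have htail : Po(r).real {j} * poissonTailRatio r (j + 1) =
      (1 - Po(r).real (Set.Iio (j + 1))) / r := by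
    unfold poissonTailRatio
    push_cast
    rw [← mul_poissonMeasure_real_singleton]
    field_simp
  have hhead : Po(r).real {j} * poissonHeadRatio r j ≤ Po(r).real (Set.Iio (j + 1)) / r := by
    unfold poissonHeadRatio
    rcases j.eq_zero_or_pos with rfl | hj
    · rw [Nat.cast_zero, zero_mul, div_zero, mul_zero]
      positivity
    · rw [le_div_iff₀ hr', ← mul_div_assoc, div_mul_eq_mul_div, div_le_iff₀ (by positivity)]
      linarith [mul_le_mul_of_nonneg_right (mul_poissonMeasure_real_Iio_le r j) hp.le]
  calc Po(r).real {j} * (poissonTailRatio r (j + 1) + poissonHeadRatio r j)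
      ≤ (1 - Po(r).real (Set.Iio (j + 1))) / r + Po(r).real (Set.Iio (j + 1)) / r := by
        rw [mul_add, htail]
        gcongr
    _ = 1 / r := by ring

lemma poissonStein_succ_sub_le (hr : 0 < r) (B : Set ℕ) (j : ℕ) :
    poissonStein r B (j + 1) - poissonStein r B j ≤ 1 / r := by
  have htail : Po(r).real (B ∩ Set.Iio j) *
      (poissonTailRatio r (j + 1) - poissonTailRatio r j) ≤ 0 := by
    rcases j.eq_zero_or_pos with rfl | hj
    · simp
    · exact mul_nonpos_of_nonneg_of_nonpos measureReal_nonneg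
        (sub_nonpos.2 (poissonTailRatio_succ_le hr hj))
  have hhead : 0 ≤ (Po(r).real B - Po(r).real (B ∩ Set.Iio (j + 1))) *
      (poissonHeadRatio r (j + 1) - poissonHeadRatio r j) :=
    mul_nonneg (sub_nonneg.2 (measureReal_mono Set.inter_subset_left))
      (sub_nonneg.2 (poissonHeadRatio_le_succ hr j))
  have hjump : B.indicator 1 j *
      (Po(r).real {j} * (poissonTailRatio r (j + 1) + poissonHeadRatio r j)) ≤ 1 / r :=
    (mul_le_of_le_one_left (mul_nonneg measureReal_nonneg
      (add_nonneg (poissonTailRatio_nonneg _ _) (poissonHeadRatio_nonneg _ _)))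
      (Set.indicator_le_self' (fun _ _ => zero_le_one) j)).trans
      (poissonMeasure_real_singleton_mul_ratio_le hr j)
  rw [poissonStein_eq_sub, poissonStein_eq_sub]
  rw [measureReal_inter_Iio_succ] at hhead ⊢
  linarith

lemma abs_poissonStein_succ_sub_le (hr : 0 < r) (B : Set ℕ) (j : ℕ) :
    |poissonStein r B (j + 1) - poissonStein r B j| ≤ 1 / r := by
  have hcompl := poissonStein_succ_sub_le hr Bᶜ j
  rw [poissonStein_compl, poissonStein_compl] at hcompl
  exact abs_le.2 ⟨by linarith, poissonStein_succ_sub_le hr B j⟩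

lemma poissonStein_singleton_succ_le (hr : 0 < r) {t j : ℕ} (h : j ≠ t) :
    poissonStein r {t} (j + 1) ≤ poissonStein r {t} j := by
  rcases h.lt_or_gt with h | h
  · rw [poissonStein_singleton_of_le r h, poissonStein_singleton_of_le r h.le]
    exact neg_le_neg (mul_le_mul_of_nonneg_left (poissonHeadRatio_le_succ hr j) measureReal_nonneg)
  · rw [poissonStein_singleton_of_lt r (h.trans j.lt_succ_self), poissonStein_singleton_of_lt r h]
    exact mul_le_mul_of_nonneg_left (poissonTailRatio_succ_le hr (by lia)) measureReal_nonneg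

/-- The solution for `{t}` starts at `0`, is nonnegative far out, and decreases except at one
upward jump of height at most `1 / r`, so its total variation is at most twice that height. -/
lemma sum_range_abs_poissonStein_singleton_le (hr : 0 < r) (t n : ℕ) :
    ∑ j ∈ Finset.range n, |poissonStein r {t} (j + 1) - poissonStein r {t} j| ≤ 2 / r := by
  set f := poissonStein r {t} with hf
  have hjump (j : ℕ) :
      |f (j + 1) - f j| ≤ -(f (j + 1) - f j) + if j = t then 2 / (r : ℝ) else 0 := by
    split_ifs with h
    · linarith [abs_le.1 (abs_poissonStein_succ_sub_le hr {t} j),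
        abs_poissonStein_succ_sub_le hr {t} j, (by ring : (2 : ℝ) / r = 1 / r + 1 / r)]
    · rw [abs_of_nonpos (sub_nonpos.2 (poissonStein_singleton_succ_le hr h)), add_zero]
  have hend : 0 ≤ f (n + t + 1) := by
    rw [hf, poissonStein_singleton_of_lt r (by lia)]
    exact mul_nonneg measureReal_nonneg (poissonTailRatio_nonneg _ _)
  calc ∑ j ∈ Finset.range n, |f (j + 1) - f j|
      ≤ ∑ j ∈ Finset.range (n + t + 1), |f (j + 1) - f j| :=
        Finset.sum_le_sum_of_subset_of_nonneg (Finset.range_subset_range.2 (by lia))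
          fun _ _ _ => abs_nonneg _
    _ ≤ ∑ j ∈ Finset.range (n + t + 1),
          (-(f (j + 1) - f j) + if j = t then 2 / (r : ℝ) else 0) :=
        Finset.sum_le_sum fun j _ => hjump j
    _ = -f (n + t + 1) + 2 / r := by
        rw [Finset.sum_add_distrib, Finset.sum_neg_distrib, Finset.sum_range_sub,
          Finset.sum_ite_eq', if_pos (Finset.mem_range.2 (by lia)), hf, poissonStein_zero,
          sub_zero]
    _ ≤ 2 / r := by linarith

end PoissonSteinEquation

section TranslatedPoissonSteinEquation

/-- The rate `v + γ`, where `γ = fract (μ - v)`, of the Poisson distribution underlying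
`translatedPoisson μ v`. -/
noncomputable def tpRate (μ v : ℝ) : ℝ≥0 := (v + Int.fract (μ - v)).toNNReal

/-- The solution of the Stein equation of `translatedPoisson μ v` for the set `A`: the Poisson one,
translated by `⌊μ - v⌋`, and extended by `0` to the left of the support through `Int.toNat`. -/
noncomputable def tpStein (μ v : ℝ) (A : Set ℤ) (k : ℤ) : ℝ :=
  poissonStein (tpRate μ v) ((fun j : ℕ => (j : ℤ) + ⌊μ - v⌋) ⁻¹' A) (k - ⌊μ - v⌋).toNat

instance isProbabilityMeasure_translatedPoisson (μ v : ℝ) :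
    IsProbabilityMeasure (translatedPoisson μ v) :=
  Measure.isProbabilityMeasure_map measurable_from_top.aemeasurable

lemma tpStein_floor_add (μ v : ℝ) (A : Set ℤ) (j : ℕ) :
    tpStein μ v A (⌊μ - v⌋ + j) =
      poissonStein (tpRate μ v) ((fun j : ℕ => (j : ℤ) + ⌊μ - v⌋) ⁻¹' A) j := by
  simp [tpStein]

lemma tpStein_floor_add_succ (μ v : ℝ) (A : Set ℤ) (j : ℕ) :
    tpStein μ v A (⌊μ - v⌋ + j + 1) =
      poissonStein (tpRate μ v) ((fun j : ℕ => (j : ℤ) + ⌊μ - v⌋) ⁻¹' A) (j + 1) := by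
  rw [add_assoc]
  exact_mod_cast tpStein_floor_add μ v A (j + 1)

lemma tpStein_of_le {μ v : ℝ} (A : Set ℤ) {k : ℤ} (h : k ≤ ⌊μ - v⌋) : tpStein μ v A k = 0 := by
  rw [tpStein, Int.toNat_of_nonpos (sub_nonpos.2 h), poissonStein_zero]

lemma tpStein_succ_sub_of_lt {μ v : ℝ} (A : Set ℤ) {k : ℤ} (h : k < ⌊μ - v⌋) :
    tpStein μ v A (k + 1) - tpStein μ v A k = 0 := by
  rw [tpStein_of_le A h.le, tpStein_of_le A (Int.add_one_le_of_lt h), sub_zero]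

variable {μ v : ℝ}

lemma coe_tpRate (hv : 0 ≤ v) : (tpRate μ v : ℝ) = v + Int.fract (μ - v) :=
  Real.coe_toNNReal _ (add_nonneg hv (Int.fract_nonneg _))

lemma le_tpRate (hv : 0 ≤ v) : v ≤ tpRate μ v := by
  rw [coe_tpRate hv]
  exact le_add_of_nonneg_right (Int.fract_nonneg _)

lemma tpRate_pos (hv : 0 < v) : 0 < tpRate μ v :=
  NNReal.coe_pos.1 (hv.trans_le (le_tpRate hv.le))

lemma tpStein_equation (hv : 0 < v) (A : Set ℤ) (k : ℤ) :
    tpRate μ v * (tpStein μ v A (k + 1) - tpStein μ v A k) - (k - μ) * tpStein μ v A k =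
      (Set.Iio ⌊μ - v⌋)ᶜ.indicator
        (fun k => A.indicator 1 k - (translatedPoisson μ v).real A) k := by
  rcases lt_or_ge k ⌊μ - v⌋ with hk | hk
  · rw [Set.indicator_of_notMem (Set.notMem_compl_iff.2 (Set.mem_Iio.2 hk)),
      tpStein_succ_sub_of_lt A hk, tpStein_of_le A hk.le]
    ring
  · obtain ⟨j, rfl⟩ := Int.le.dest hk
    have hmap : (translatedPoisson μ v).real A =
        Po(tpRate μ v).real ((fun j : ℕ => (j : ℤ) + ⌊μ - v⌋) ⁻¹' A) :=
      map_measureReal_apply measurable_from_top .of_discrete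
    have hindicator : A.indicator (1 : ℤ → ℝ) (⌊μ - v⌋ + j) =
        ((fun j : ℕ => (j : ℤ) + ⌊μ - v⌋) ⁻¹' A).indicator 1 j := by
      rw [add_comm]
      rfl
    have hrate : (tpRate μ v : ℝ) = μ - ⌊μ - v⌋ := by
      rw [coe_tpRate hv.le, Int.fract]
      ring
    rw [Set.indicator_of_mem (Set.mem_compl (Set.notMem_Iio.2 hk)), hmap, hindicator,
      ← poissonStein_equation (tpRate_pos hv), tpStein_floor_add_succ, tpStein_floor_add,
      hrate]
    push_cast
    ring

lemma abs_tpStein_succ_sub_le (hv : 0 < v) (A : Set ℤ) (k : ℤ) :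
    |tpStein μ v A (k + 1) - tpStein μ v A k| ≤ 1 / v := by
  rcases lt_or_ge k ⌊μ - v⌋ with hk | hk
  · rw [tpStein_succ_sub_of_lt A hk, abs_zero]
    positivity
  · obtain ⟨j, rfl⟩ := Int.le.dest hk
    rw [tpStein_floor_add_succ, tpStein_floor_add]
    exact (abs_poissonStein_succ_sub_le (tpRate_pos hv) _ j).trans
      (one_div_le_one_div_of_le hv (le_tpRate hv.le))

lemma sum_range_abs_tpStein_singleton_le (hv : 0 < v) (k₀ : ℤ) (n : ℕ) :
    ∑ j ∈ Finset.range n, |tpStein μ v {k₀} (⌊μ - v⌋ + j + 1) - tpStein μ v {k₀} (⌊μ - v⌋ + j)| ≤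
      2 / v := by
  have hinj : Function.Injective (fun j : ℕ => (j : ℤ) + ⌊μ - v⌋) :=
    (add_left_injective _).comp Nat.cast_injective
  simp only [tpStein_floor_add_succ, tpStein_floor_add]
  rcases (Set.subsingleton_singleton.preimage hinj :
    ((fun j : ℕ => (j : ℤ) + ⌊μ - v⌋) ⁻¹' {k₀}).Subsingleton).eq_empty_or_singleton with h | ⟨t, h⟩
  · simp only [h, poissonStein, Set.empty_inter, measureReal_empty, zero_mul, sub_zero, zero_div,
      abs_zero, Finset.sum_const_zero]
    positivity
  · rw [h]
    exact (sum_range_abs_poissonStein_singleton_le (tpRate_pos hv) t n).trans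
      (div_le_div_of_nonneg_left zero_le_two hv (le_tpRate hv.le))

lemma support_abs_tpStein_succ_sub_subset (A : Set ℤ) :
    (Function.support fun k => |tpStein μ v A (k + 1) - tpStein μ v A k|) ⊆
      Set.range fun j : ℕ => ⌊μ - v⌋ + (j : ℤ) := fun k hk => by
  by_contra h
  refine hk (abs_eq_zero.2 (tpStein_succ_sub_of_lt A (not_le.1 fun hle => h ?_)))
  exact Int.le.dest hle

lemma summable_abs_tpStein_singleton_succ_sub (hv : 0 < v) (k₀ : ℤ) :
    Summable fun k => |tpStein μ v {k₀} (k + 1) - tpStein μ v {k₀} k| := by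
  have hinj : Function.Injective fun j : ℕ => ⌊μ - v⌋ + (j : ℤ) :=
    (add_right_injective _).comp Nat.cast_injective
  rw [← hinj.summable_iff fun k hk => Function.notMem_support.1
    fun h => hk (support_abs_tpStein_succ_sub_subset _ h)]
  exact summable_of_sum_range_le (fun _ => abs_nonneg _) (sum_range_abs_tpStein_singleton_le hv k₀)

lemma tsum_abs_tpStein_singleton_succ_sub_le (hv : 0 < v) (k₀ : ℤ) :
    ∑' k, |tpStein μ v {k₀} (k + 1) - tpStein μ v {k₀} k| ≤ 2 / v := by
  have hinj : Function.Injective fun j : ℕ => ⌊μ - v⌋ + (j : ℤ) :=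
    (add_right_injective _).comp Nat.cast_injective
  rw [← hinj.tsum_eq (support_abs_tpStein_succ_sub_subset _)]
  exact Real.tsum_le_of_sum_range_le (fun _ => abs_nonneg _)
    (sum_range_abs_tpStein_singleton_le hv k₀)

end TranslatedPoissonSteinEquation

section Integrals

variable {Ω : Type*} {mΩ : MeasurableSpace Ω} {P : Measure Ω}

lemma integral_abs_mul_abs_le_sqrt_mul_sqrt {X Y : Ω → ℝ} (hX : MemLp X 2 P) (hY : MemLp Y 2 P) :
    ∫ ω, |X ω| * |Y ω| ∂P ≤ √(∫ ω, X ω ^ 2 ∂P) * √(∫ ω, Y ω ^ 2 ∂P) := by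
  have h := integral_mul_le_Lp_mul_Lq_of_nonneg (μ := P) Real.HolderConjugate.two_two
    (.of_forall fun ω => abs_nonneg (X ω)) (.of_forall fun ω => abs_nonneg (Y ω))
    (by simpa using hX.norm) (by simpa using hY.norm)
  simpa only [Real.rpow_two, sq_abs, ← Real.sqrt_eq_rpow] using h

lemma integral_abs_sub_le_sqrt_variance [IsProbabilityMeasure P] {X : Ω → ℝ} (hX : MemLp X 2 P) :
    ∫ ω, |X ω - P[X]| ∂P ≤ √Var[X; P] := by
  have h := integral_abs_mul_abs_le_sqrt_mul_sqrt (hX.sub (memLp_const P[X]))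
    (memLp_const (1 : ℝ))
  simpa [variance_eq_integral hX.aemeasurable] using h

lemma integral_mul_le_mul_tsum {α : Type*} [Countable α] [MeasurableSpace α]
    [MeasurableSingletonClass α] {ν : Measure α} {g h : α → ℝ} {C : ℝ} (hh : ∀ a, 0 ≤ h a)
    (hg : ∀ a, 0 ≤ g a) (hgs : Summable g) (hC : ∀ a, ν.real {a} * h a ≤ C) :
    ∫ a, h a * g a ∂ν ≤ C * ∑' a, g a := by
  have hle (a : α) : ν.real {a} • (h a * g a) ≤ C * g a := by
    rw [smul_eq_mul, ← mul_assoc]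
    exact mul_le_mul_of_nonneg_right (hC a) (hg a)
  have hnonneg (a : α) : 0 ≤ ν.real {a} • (h a * g a) :=
    smul_nonneg measureReal_nonneg (mul_nonneg (hh a) (hg a))
  rw [← tsum_mul_left]
  by_cases hint : Integrable (fun a => h a * g a) ν
  · rw [integral_countable hint]
    exact (Summable.of_nonneg_of_le hnonneg hle (hgs.mul_left C)).tsum_le_tsum hle
      (hgs.mul_left C)
  · rw [integral_undef hint]
    exact tsum_nonneg fun a => (hnonneg a).trans (hle a)

lemma measureReal_singleton_le_qMax (ν : Measure ℤ) [IsProbabilityMeasure ν] (k : ℤ) :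
    ν.real {k} ≤ qMax ν :=
  le_ciSup (f := fun k : ℤ => ν.real {k})
    ⟨1, Set.forall_mem_range.2 fun _ => measureReal_le_one⟩ k

lemma abs_sub_zero_le_mul_abs {f : ℤ → ℝ} {C : ℝ} (hf : ∀ k, |f (k + 1) - f k| ≤ C) (k : ℤ) :
    |f k - f 0| ≤ C * |(k : ℝ)| := by
  induction k with
  | zero => simp
  | succ j ih =>
    have habs : |(((j : ℤ) + 1 : ℤ) : ℝ)| = |((j : ℤ) : ℝ)| + 1 := by
      push_cast
      rw [Nat.abs_cast, abs_of_nonneg (by positivity)]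
    rw [habs]
    linarith [abs_sub_le (f (j + 1)) (f j) (f 0), hf j]
  | pred j ih =>
    have habs : |((-(j : ℤ) - 1 : ℤ) : ℝ)| = |((-(j : ℤ) : ℤ) : ℝ)| + 1 := by
      push_cast
      rw [abs_neg, Nat.abs_cast, abs_of_nonpos (by linarith [Nat.cast_nonneg (α := ℝ) j])]
      ring
    have hstep := hf (-(j : ℤ) - 1)
    rw [sub_add_cancel, abs_sub_comm] at hstep
    rw [habs]
    linarith [abs_sub_le (f (-(j : ℤ) - 1)) (f (-(j : ℤ))) (f 0)]

lemma memLp_comp_of_abs_succ_sub_le [IsFiniteMeasure P] {W : Ω → ℤ} (hW : Measurable W)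
    {p : ENNReal} (hWp : MemLp (fun ω => (W ω : ℝ)) p P) {f : ℤ → ℝ} {C : ℝ}
    (hf : ∀ k, |f (k + 1) - f k| ≤ C) : MemLp (fun ω => f (W ω)) p P := by
  have hsub : MemLp (fun ω => f (W ω) - f 0) p P :=
    hWp.of_le_mul ((measurable_from_top.comp hW).sub_const _).aestronglyMeasurable
      (.of_forall fun ω => abs_sub_zero_le_mul_abs hf (W ω))
  simpa [Pi.add_def] using hsub.add (memLp_const (f 0))

end Integrals

section SteinCoefficient

variable {Ω : Type*} {mΩ : MeasurableSpace Ω} {P : Measure Ω} {W : Ω → ℤ} {μ : ℝ} {T : Ω → ℝ}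

/-- `T` is a discrete Stein coefficient of the integer valued random variable `W` about `μ`:
`E[(W - μ) f(W)] = E[T (f(W + 1) - f(W))]` for every `f : ℤ → ℝ` with bounded increments. -/
def IsSteinCoefficient (P : Measure Ω) (W : Ω → ℤ) (μ : ℝ) (T : Ω → ℝ) : Prop :=
  ∀ (f : ℤ → ℝ) (C : ℝ), (∀ k, |f (k + 1) - f k| ≤ C) →
    ∫ ω, (W ω - μ) * f (W ω) ∂P = ∫ ω, T ω * (f (W ω + 1) - f (W ω)) ∂P

namespace IsSteinCoefficient

lemma integral_eq [IsProbabilityMeasure P] (h : IsSteinCoefficient P W μ T)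
    (hW1 : Integrable (fun ω => (W ω : ℝ)) P) : ∫ ω, (W ω : ℝ) ∂P = μ := by
  have hone := h (fun _ => 1) 0 fun _ => by simp
  simp only [mul_one, sub_self, mul_zero, integral_zero] at hone
  rw [integral_sub hW1 (integrable_const μ), integral_const, probReal_univ, one_smul] at hone
  exact sub_eq_zero.1 hone

lemma integral_coefficient_eq_variance [IsProbabilityMeasure P] (h : IsSteinCoefficient P W μ T)
    (hW2 : MemLp (fun ω => (W ω : ℝ)) 2 P) :
    ∫ ω, T ω ∂P = Var[fun ω => (W ω : ℝ); P] := by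
  have hmean := h.integral_eq (hW2.integrable one_le_two)
  have hid := h (fun k => k) 1 fun k => by simp
  simp only [Int.cast_add, Int.cast_one, add_sub_cancel_left, mul_one] at hid
  rw [← hid, ← covariance_self hW2.aemeasurable, covariance_eq_sub hW2 hW2, hmean]
  have hsq : Integrable (fun ω => (W ω : ℝ) * W ω) P := hW2.integrable_mul hW2
  simp only [sub_mul, Pi.mul_apply]
  rw [integral_sub hsq ((hW2.integrable one_le_two).const_mul μ), integral_const_mul, hmean]

lemma map_id_of_ae_eq_comp (h : IsSteinCoefficient P W μ T) (hW : Measurable W) {τ : ℤ → ℝ}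
    (hτ : T =ᵐ[P] fun ω => τ (W ω)) : IsSteinCoefficient (P.map W) id μ τ := fun f C hf => by
  have hmap : ∀ g : ℤ → ℝ, ∫ k, g k ∂P.map W = ∫ ω, g (W ω) ∂P := fun g =>
    integral_map hW.aemeasurable measurable_from_top.aestronglyMeasurable
  simp only [id_eq, hmap (fun k => (k - μ) * f k), hmap (fun k => τ k * (f (k + 1) - f k)),
    h f C hf]
  refine integral_congr_ae (hτ.mono fun ω hω => ?_)
  simp only [hω]

end IsSteinCoefficient

lemma measureReal_le_mean_sub_variance_le [IsProbabilityMeasure P] {X : Ω → ℝ} (hX : MemLp X 2 P)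
    (hv : 0 < Var[X; P]) : P.real {ω | X ω ≤ P[X] - Var[X; P]} ≤ 1 / Var[X; P] := by
  have hsub : {ω | X ω ≤ P[X] - Var[X; P]} ⊆ {ω | Var[X; P] ≤ |X ω - P[X]|} := fun ω hω =>
    (le_sub_comm.1 hω).trans ((neg_sub (X ω) P[X]).symm.le.trans (neg_le_abs _))
  calc P.real {ω | X ω ≤ P[X] - Var[X; P]} ≤ Var[X; P] / Var[X; P] ^ 2 :=
        (measureReal_mono hsub).trans
          (ENNReal.toReal_le_of_le_ofReal (by positivity) (meas_ge_le_variance_div_sq hX hv))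
    _ = 1 / Var[X; P] := by field_simp

lemma abs_measureReal_sub_le_add {α : Type*} [MeasurableSpace α] {ν : Measure α}
    [IsProbabilityMeasure ν] {A B : Set α} (hA : MeasurableSet A) (hB : MeasurableSet B) {q : ℝ}
    (hq : q ∈ Set.Icc 0 1) :
    |ν.real A - q| ≤ |∫ x in Bᶜ, (A.indicator 1 x - q) ∂ν| + ν.real B := by
  have hint : Integrable (A.indicator (1 : α → ℝ)) ν := (integrable_const 1).indicator hA
  have hsplit : ν.real A - q = ∫ x in B, (A.indicator 1 x - q) ∂ν +
      ∫ x in Bᶜ, (A.indicator 1 x - q) ∂ν := by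
    have hsub : Integrable (fun x => A.indicator 1 x - q) ν := hint.sub (integrable_const q)
    rw [integral_add_compl hB hsub, integral_sub hint (integrable_const q),
      integral_indicator_one hA, integral_const, probReal_univ, one_smul]
  have hbound (x : α) : ‖A.indicator 1 x - q‖ ≤ 1 := by
    obtain ⟨hq0, hq1⟩ := hq
    by_cases hx : x ∈ A <;> simp only [Set.indicator, hx, if_true, if_false, Pi.one_apply] <;>
      exact abs_le.2 ⟨by linarith, by linarith⟩
  rw [hsplit, add_comm]
  refine (abs_add_le _ _).trans (add_le_add_right ?_ _)
  simpa using norm_setIntegral_le_of_norm_le_const (measure_lt_top ν B) fun x _ => hbound x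

lemma abs_integral_tpRate_sub_mul_le [IsProbabilityMeasure P] {v : ℝ} (hT : Integrable T P)
    (hv : 0 < v) {D : Ω → ℝ} (hDmeas : AEStronglyMeasurable D P) (hD : ∀ ω, |D ω| ≤ 1 / v) :
    |∫ ω, (tpRate μ v - T ω) * D ω ∂P| ≤ ∫ ω, |T ω - v| * |D ω| ∂P + 1 / v := by
  have hint : Integrable (fun ω => |T ω - v| * |D ω|) P :=
    (hT.sub (integrable_const v)).abs.mul_bdd (c := 1 / v) hDmeas.norm
      (.of_forall fun ω => by simpa using hD ω)
  have hpoint (ω : Ω) : ‖(tpRate μ v - T ω) * D ω‖ ≤ |T ω - v| * |D ω| + 1 / v := by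
    have hrate : |tpRate μ v - T ω| ≤ |T ω - v| + 1 := by
      rw [coe_tpRate hv.le, abs_sub_comm (T ω), add_sub_right_comm]
      exact (abs_add_le _ _).trans
        (add_le_add_right (abs_le.2 ⟨by linarith [Int.fract_nonneg (μ - v)],
          (Int.fract_lt_one _).le⟩) _)
    rw [Real.norm_eq_abs, abs_mul]
    linarith [mul_le_mul_of_nonneg_right hrate (abs_nonneg (D ω)), hD ω]
  calc |∫ ω, (tpRate μ v - T ω) * D ω ∂P| ≤ ∫ ω, (|T ω - v| * |D ω| + 1 / v) ∂P :=
        norm_integral_le_of_norm_le (hint.add (integrable_const _)) (.of_forall hpoint)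
    _ = ∫ ω, |T ω - v| * |D ω| ∂P + 1 / v := by
        rw [integral_add hint (integrable_const _), integral_const, probReal_univ, one_smul]

lemma integral_sq_tpStein_singleton_succ_sub_le [IsProbabilityMeasure P] (hW : Measurable W) {v : ℝ}
    (hv : 0 < v) (k₀ : ℤ) :
    ∫ ω, (tpStein μ v {k₀} (W ω + 1) - tpStein μ v {k₀} (W ω)) ^ 2 ∂P ≤
      2 * qMax (P.map W) / v ^ 2 := by
  have : IsProbabilityMeasure (P.map W) := Measure.isProbabilityMeasure_map hW.aemeasurable
  set Δ : ℤ → ℝ := fun k => tpStein μ v {k₀} (k + 1) - tpStein μ v {k₀} k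
  have hq (k : ℤ) : (P.map W).real {k} * |Δ k| ≤ qMax (P.map W) * (1 / v) :=
    mul_le_mul (measureReal_singleton_le_qMax _ k) (abs_tpStein_succ_sub_le hv _ k)
      (abs_nonneg _) (measureReal_nonneg.trans (measureReal_singleton_le_qMax _ k))
  calc ∫ ω, Δ (W ω) ^ 2 ∂P = ∫ k, |Δ k| * |Δ k| ∂P.map W := by
        rw [integral_map hW.aemeasurable measurable_from_top.aestronglyMeasurable]
        simp only [abs_mul_abs_self, sq]
    _ ≤ qMax (P.map W) * (1 / v) * ∑' k, |Δ k| :=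
        integral_mul_le_mul_tsum (fun _ => abs_nonneg _) (fun _ => abs_nonneg _)
          (summable_abs_tpStein_singleton_succ_sub hv k₀) hq
    _ ≤ qMax (P.map W) * (1 / v) * (2 / v) :=
        mul_le_mul_of_nonneg_left (tsum_abs_tpStein_singleton_succ_sub_le hv k₀)
          ((mul_nonneg measureReal_nonneg (abs_nonneg _)).trans (hq 0))
    _ = 2 * qMax (P.map W) / v ^ 2 := by ring

namespace IsSteinCoefficient

variable [IsProbabilityMeasure P] {v : ℝ}

lemma integral_tpRate_sub_mul (h : IsSteinCoefficient P W μ T) (hW : Measurable W)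
    (hW2 : MemLp (fun ω => (W ω : ℝ)) 2 P) (hT : Integrable T P) (hv : 0 < v) (A : Set ℤ) :
    ∫ ω, (tpRate μ v - T ω) * (tpStein μ v A (W ω + 1) - tpStein μ v A (W ω)) ∂P =
      ∫ k in (Set.Iio ⌊μ - v⌋)ᶜ, (A.indicator 1 k - (translatedPoisson μ v).real A) ∂P.map W := by
  have hbound := abs_tpStein_succ_sub_le (μ := μ) hv A
  have hΔmeas : AEStronglyMeasurable
      (fun ω => tpStein μ v A (W ω + 1) - tpStein μ v A (W ω)) P :=
    ((measurable_from_top (f := fun k => tpStein μ v A (k + 1) - tpStein μ v A k)).comp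
      hW).aestronglyMeasurable
  have hΔ : Integrable (fun ω => tpStein μ v A (W ω + 1) - tpStein μ v A (W ω)) P :=
    .of_bound hΔmeas (1 / v) (.of_forall fun ω => hbound (W ω))
  have hTΔ : Integrable (fun ω => T ω * (tpStein μ v A (W ω + 1) - tpStein μ v A (W ω))) P :=
    hT.mul_bdd (c := 1 / v) hΔmeas (.of_forall fun ω => hbound (W ω))
  have hWf : Integrable (fun ω => ((W ω : ℝ) - μ) * tpStein μ v A (W ω)) P :=
    (hW2.sub (memLp_const μ)).integrable_mul (memLp_comp_of_abs_succ_sub_le hW hW2 hbound)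
  calc ∫ ω, (tpRate μ v - T ω) * (tpStein μ v A (W ω + 1) - tpStein μ v A (W ω)) ∂P
      = ∫ ω, tpRate μ v * (tpStein μ v A (W ω + 1) - tpStein μ v A (W ω)) ∂P -
          ∫ ω, (W ω - μ) * tpStein μ v A (W ω) ∂P := by
        rw [h _ _ hbound, ← integral_sub (hΔ.const_mul _) hTΔ]
        simp only [sub_mul]
    _ = ∫ ω, (Set.Iio ⌊μ - v⌋)ᶜ.indicator
          (fun k => A.indicator 1 k - (translatedPoisson μ v).real A) (W ω) ∂P := by
        rw [← integral_sub (hΔ.const_mul _) hWf]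
        simp only [tpStein_equation hv]
    _ = _ := by
        rw [← integral_indicator .of_discrete, integral_map hW.aemeasurable
          measurable_from_top.aestronglyMeasurable]

lemma abs_measureReal_map_sub_translatedPoisson_le (h : IsSteinCoefficient P W μ T)
    (hW : Measurable W) (hW2 : MemLp (fun ω => (W ω : ℝ)) 2 P) (hT : Integrable T P)
    (hvar : Var[fun ω => (W ω : ℝ); P] = v) (hv : 0 < v) (A : Set ℤ) :
    |(P.map W).real A - (translatedPoisson μ v).real A| ≤
      ∫ ω, |T ω - v| * |tpStein μ v A (W ω + 1) - tpStein μ v A (W ω)| ∂P + 2 / v := by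
  have : IsProbabilityMeasure (P.map W) := Measure.isProbabilityMeasure_map hW.aemeasurable
  have hbulk := abs_integral_tpRate_sub_mul_le (μ := μ) hT hv
    (D := fun ω => tpStein μ v A (W ω + 1) - tpStein μ v A (W ω))
    ((measurable_from_top (f := fun k => tpStein μ v A (k + 1) - tpStein μ v A k)).comp
      hW).aestronglyMeasurable fun ω => abs_tpStein_succ_sub_le hv A (W ω)
  have htail : (P.map W).real (Set.Iio ⌊μ - v⌋) ≤ 1 / v := by
    have hcheb := measureReal_le_mean_sub_variance_le hW2 (hvar ▸ hv)
    rw [h.integral_eq (hW2.integrable one_le_two), hvar] at hcheb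
    rw [map_measureReal_apply hW .of_discrete]
    refine le_trans (measureReal_mono fun ω hω => ?_) hcheb
    exact Int.le_floor.1 (Set.mem_Iio.1 hω).le
  have hsplit := abs_measureReal_sub_le_add (ν := P.map W) (A := A) (B := Set.Iio ⌊μ - v⌋)
    .of_discrete .of_discrete (q := (translatedPoisson μ v).real A)
    ⟨measureReal_nonneg, measureReal_le_one⟩
  rw [← h.integral_tpRate_sub_mul hW hW2 hT hv] at hsplit
  linarith [(by ring : (2 : ℝ) / v = 1 / v + 1 / v)]

theorem dTV_map_translatedPoisson_le (h : IsSteinCoefficient P W μ T) (hW : Measurable W)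
    (hW2 : MemLp (fun ω => (W ω : ℝ)) 2 P) (hT : MemLp T 2 P)
    (hvar : Var[fun ω => (W ω : ℝ); P] = v) (hv : 0 < v) :
    dTV (P.map W) (translatedPoisson μ v) ≤ √Var[T; P] / v + 2 / v := by
  refine ciSup_le fun A => (h.abs_measureReal_map_sub_translatedPoisson_le hW hW2
    (hT.integrable one_le_two) hvar hv A).trans (add_le_add_left ?_ _)
  have hTv : P[T] = v := (h.integral_coefficient_eq_variance hW2).trans hvar
  have hint : Integrable (fun ω => |T ω - v| * (1 / v)) P :=
    ((hT.integrable one_le_two).sub (integrable_const v)).abs.mul_const _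
  calc ∫ ω, |T ω - v| * |tpStein μ v A (W ω + 1) - tpStein μ v A (W ω)| ∂P
      ≤ ∫ ω, |T ω - v| * (1 / v) ∂P :=
        integral_mono_of_nonneg (.of_forall fun ω => by positivity) hint (.of_forall fun ω =>
          mul_le_mul_of_nonneg_left (abs_tpStein_succ_sub_le hv A (W ω)) (abs_nonneg _))
    _ = (∫ ω, |T ω - P[T]| ∂P) / v := by rw [integral_mul_const, hTv, mul_one_div]
    _ ≤ √Var[T; P] / v := by gcongr; exact integral_abs_sub_le_sqrt_variance hT

theorem dLoc_map_translatedPoisson_le (h : IsSteinCoefficient P W μ T) (hW : Measurable W)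
    (hW2 : MemLp (fun ω => (W ω : ℝ)) 2 P) (hT : MemLp T 2 P)
    (hvar : Var[fun ω => (W ω : ℝ); P] = v) (hv : 0 < v) :
    dLoc (P.map W) (translatedPoisson μ v) ≤
      2 * √(qMax (P.map W) * Var[T; P]) / v + 2 / v := by
  refine ciSup_le fun k₀ => (h.abs_measureReal_map_sub_translatedPoisson_le hW hW2
    (hT.integrable one_le_two) hvar hv {k₀}).trans (add_le_add_left ?_ _)
  have hTv : P[T] = v := (h.integral_coefficient_eq_variance hW2).trans hvar
  have hΔ : MemLp (fun ω => tpStein μ v {k₀} (W ω + 1) - tpStein μ v {k₀} (W ω)) 2 P :=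
    .of_bound ((measurable_from_top (f := fun k => tpStein μ v {k₀} (k + 1) -
      tpStein μ v {k₀} k)).comp hW).aestronglyMeasurable (1 / v)
      (.of_forall fun ω => abs_tpStein_succ_sub_le hv _ (W ω))
  calc ∫ ω, |T ω - v| * |tpStein μ v {k₀} (W ω + 1) - tpStein μ v {k₀} (W ω)| ∂P
      ≤ √(∫ ω, (T ω - v) ^ 2 ∂P) *
          √(∫ ω, (tpStein μ v {k₀} (W ω + 1) - tpStein μ v {k₀} (W ω)) ^ 2 ∂P) :=
        integral_abs_mul_abs_le_sqrt_mul_sqrt (hT.sub (memLp_const v)) hΔ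
    _ ≤ √Var[T; P] * √(2 * qMax (P.map W) / v ^ 2) := by
        rw [variance_eq_integral hT.aemeasurable, hTv]
        gcongr
        exact integral_sq_tpStein_singleton_succ_sub_le hW hv k₀
    _ = √2 * √(qMax (P.map W) * Var[T; P]) / v := by
        rw [Real.sqrt_div' _ (sq_nonneg v), Real.sqrt_sq hv.le, Real.sqrt_mul zero_le_two,
          Real.sqrt_mul' _ (variance_nonneg T P)]
        ring
    _ ≤ 2 * √(qMax (P.map W) * Var[T; P]) / v := by
        gcongr
        exact Real.sqrt_le_iff.2 ⟨zero_le_two, by norm_num⟩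

theorem dLoc_translatedPoisson_le_of_forall_mul_abs_le {ν : Measure ℤ} [IsProbabilityMeasure ν]
    {τ : ℤ → ℝ} (h : IsSteinCoefficient ν id μ τ) (hν : MemLp (fun k : ℤ => (k : ℝ)) 2 ν)
    (hτ : Integrable τ ν) (hvar : lawVar ν = v) (hv : 0 < v) {C : ℝ}
    (hC : ∀ k, ν.real {k} * |τ k - v| ≤ C) :
    dLoc ν (translatedPoisson μ v) ≤ (2 * C + 2) / v := by
  refine ciSup_le fun k₀ => ?_
  have hstein := h.abs_measureReal_map_sub_translatedPoisson_le measurable_id hν hτ hvar hv {k₀}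
  rw [Measure.map_id] at hstein
  refine hstein.trans ?_
  have hC0 : 0 ≤ C := (mul_nonneg measureReal_nonneg (abs_nonneg _)).trans (hC 0)
  rw [add_div]
  gcongr
  calc ∫ k, |τ k - v| * |tpStein μ v {k₀} (k + 1) - tpStein μ v {k₀} k| ∂ν
      ≤ C * ∑' k, |tpStein μ v {k₀} (k + 1) - tpStein μ v {k₀} k| :=
        integral_mul_le_mul_tsum (fun _ => abs_nonneg _) (fun _ => abs_nonneg _)
          (summable_abs_tpStein_singleton_succ_sub hv k₀) hC
    _ ≤ C * (2 / v) := by gcongr; exact tsum_abs_tpStein_singleton_succ_sub_le hv k₀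
    _ = 2 * C / v := by ring

end IsSteinCoefficient

end SteinCoefficient

section ExchangeablePair

variable {Ω : Type*} {mΩ : MeasurableSpace Ω} {P : Measure Ω} {W W' : Ω → ℤ} {μ l : ℝ}

lemma variance_div_const (X : Ω → ℝ) (c : ℝ) : Var[fun ω => X ω / c; P] = Var[X; P] / c ^ 2 := by
  simp only [div_eq_mul_inv, variance_mul_const, inv_pow]

lemma integral_condExp_mul_comp [IsFiniteMeasure P] (hW : Measurable W) {X : Ω → ℝ}
    (hX : Integrable X P) {g : ℤ → ℝ} (hXg : Integrable (fun ω => X ω * g (W ω)) P) :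
    ∫ ω, P[X | MeasurableSpace.comap W inferInstance] ω * g (W ω) ∂P =
      ∫ ω, X ω * g (W ω) ∂P := by
  have hg : StronglyMeasurable[MeasurableSpace.comap W inferInstance] fun ω => g (W ω) :=
    (measurable_from_top.comp (comap_measurable W)).stronglyMeasurable
  rw [← integral_condExp hW.comap_le (f := fun ω => X ω * g (W ω))]
  exact integral_congr_ae (condExp_mul_of_stronglyMeasurable_right hg hXg hX).symm

lemma IsExchangeablePair.integral_swap (h : IsExchangeablePair P W W') (G : ℤ × ℤ → ℝ) :
    ∫ ω, G (W ω, W' ω) ∂P = ∫ ω, G (W' ω, W ω) ∂P := by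
  obtain ⟨hW, hW', hlaw⟩ := h
  rw [← integral_map (hW.prodMk hW').aemeasurable Measurable.of_discrete.aestronglyMeasurable,
    hlaw,
    integral_map (hW'.prodMk hW).aemeasurable Measurable.of_discrete.aestronglyMeasurable]

lemma integral_up_mul_succ_sub (h : IsExchangeablePair P W W')
    (hstep : ∀ᵐ ω ∂P, W' ω - W ω ∈ ({-1, 0, 1} : Set ℤ)) {f : ℤ → ℝ}
    (hf : Integrable (fun ω => f (W ω)) P) (hf' : Integrable (fun ω => f (W ω + 1)) P) :
    ∫ ω, {ω | W' ω = W ω + 1}.indicator (fun _ => 1) ω * (f (W ω + 1) - f (W ω)) ∂P =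
      -∫ ω, ((W' ω : ℝ) - W ω) * f (W ω) ∂P := by
  have hup : MeasurableSet {ω | W' ω = W ω + 1} := measurableSet_eq_fun h.2.1 (h.1.add_const 1)
  have hdown : MeasurableSet {ω | W' ω = W ω - 1} := measurableSet_eq_fun h.2.1 (h.1.sub_const 1)
  have hdiff : ∫ ω, ((W' ω : ℝ) - W ω) * f (W ω) ∂P =
      ∫ ω, ({ω | W' ω = W ω + 1}.indicator (fun ω => f (W ω)) ω -
        {ω | W' ω = W ω - 1}.indicator (fun ω => f (W ω)) ω) ∂P := by
    refine integral_congr_ae (hstep.mono fun ω hω => ?_)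
    obtain ⟨k, hk⟩ : ∃ k, W' ω = W ω + k := ⟨W' ω - W ω, by ring⟩
    rw [hk, add_sub_cancel_left] at hω
    rcases hω with rfl | rfl | rfl <;> simp [hk, sub_eq_add_neg]
  have hswap : ∫ ω, {ω | W' ω = W ω - 1}.indicator (fun ω => f (W ω)) ω ∂P =
      ∫ ω, {ω | W' ω = W ω + 1}.indicator (fun ω => f (W ω + 1)) ω ∂P := by
    refine (h.integral_swap ({p | p.2 = p.1 - 1}.indicator fun p => f p.1)).trans ?_
    congr 1 with ω
    simp only [Set.indicator_apply, Set.mem_ofPred_eq, eq_sub_iff_add_eq, eq_comm (a := W ω + 1)]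
    split_ifs with hω
    · rw [hω]
    · rfl
  rw [hdiff, integral_sub (hf.indicator hup) (hf.indicator hdown), hswap, neg_sub,
    ← integral_sub (hf'.indicator hup) (hf.indicator hup)]
  congr 1 with ω
  by_cases hω : ω ∈ {ω | W' ω = W ω + 1} <;> simp [hω]

variable [IsProbabilityMeasure P]

lemma integral_sub_mul_comp_of_regressionCondition (hW : Measurable W)
    (hW2 : MemLp (fun ω => (W ω : ℝ)) 2 P) (hW'2 : MemLp (fun ω => (W' ω : ℝ)) 2 P)
    (hreg : RegressionCondition P W W' μ l fun _ => 0) {f : ℤ → ℝ}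
    (hf : MemLp (fun ω => f (W ω)) 2 P) :
    ∫ ω, ((W' ω : ℝ) - W ω) * f (W ω) ∂P = -l * ∫ ω, (W ω - μ) * f (W ω) ∂P := by
  have hint : Integrable (fun ω => ((W ω : ℝ) - μ) * f (W ω)) P :=
    (hW2.sub (memLp_const μ)).integrable_mul hf
  have hint' : Integrable (fun ω => ((W' ω : ℝ) - μ) * f (W ω)) P :=
    (hW'2.sub (memLp_const μ)).integrable_mul hf
  have hpull : ∫ ω, ((W' ω : ℝ) - μ) * f (W ω) ∂P =
      (1 - l) * ∫ ω, (W ω - μ) * f (W ω) ∂P := by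
    have hW'μ : Integrable (fun ω => (W' ω : ℝ) - μ) P :=
      (hW'2.integrable one_le_two).sub (integrable_const μ)
    rw [← integral_condExp_mul_comp hW hW'μ hint', ← integral_const_mul]
    refine integral_congr_ae (hreg.mono fun ω hω => ?_)
    simp only [hω]
    ring
  calc ∫ ω, ((W' ω : ℝ) - W ω) * f (W ω) ∂P
      = ∫ ω, (((W' ω : ℝ) - μ) * f (W ω) - ((W ω : ℝ) - μ) * f (W ω)) ∂P := by
        congr 1 with ω
        ring
    _ = -l * ∫ ω, (W ω - μ) * f (W ω) ∂P := by
        rw [integral_sub hint' hint, hpull]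
        ring

theorem isSteinCoefficient_upProb_div (h : IsExchangeablePair P W W')
    (hreg : RegressionCondition P W W' μ l fun _ => 0) (hl : l ≠ 0)
    (hstep : ∀ᵐ ω ∂P, W' ω - W ω ∈ ({-1, 0, 1} : Set ℤ))
    (hW2 : MemLp (fun ω => (W ω : ℝ)) 2 P) :
    IsSteinCoefficient P W μ fun ω => upProb P W W' ω / l := fun f C hf => by
  have hf2 : MemLp (fun ω => f (W ω)) 2 P := memLp_comp_of_abs_succ_sub_le h.1 hW2 hf
  have hf2' : MemLp (fun ω => f (W ω + 1)) 2 P :=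
    memLp_comp_of_abs_succ_sub_le (f := fun k => f (k + 1)) h.1 hW2 fun k => hf (k + 1)
  have hW'2 : MemLp (fun ω => (W' ω : ℝ)) 2 P := by
    have hdiff : MemLp (fun ω => ((W' ω - W ω : ℤ) : ℝ)) 2 P :=
      .of_bound (measurable_from_top.comp (h.2.1.sub h.1)).aestronglyMeasurable 1
        (hstep.mono fun ω hω => by
          rcases hω with hω | hω | (hω : _ = 1) <;> simp only [hω] <;> simp)
    simpa [Pi.add_def] using hW2.add hdiff
  have hup : Integrable ({ω | W' ω = W ω + 1}.indicator fun _ => (1 : ℝ)) P :=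
    (integrable_const 1).indicator (measurableSet_eq_fun h.2.1 (h.1.add_const 1))
  have hupΔ : Integrable (fun ω => {ω | W' ω = W ω + 1}.indicator (fun _ => (1 : ℝ)) ω *
      (f (W ω + 1) - f (W ω))) P :=
    hup.mul_bdd (c := C) (hf2'.sub hf2).aestronglyMeasurable (.of_forall fun ω => hf (W ω))
  simp only [div_mul_eq_mul_div]
  rw [integral_div, upProb, integral_condExp_mul_comp (g := fun k => f (k + 1) - f k) h.1 hup hupΔ,
    integral_up_mul_succ_sub h hstep (hf2.integrable one_le_two) (hf2'.integrable one_le_two),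
    integral_sub_mul_comp_of_regressionCondition h.1 hW2 hW'2 hreg hf2]
  field_simp

lemma memLp_upProb (hW : Measurable W) (hW' : Measurable W') : MemLp (upProb P W W') 2 P :=
  ((memLp_const (1 : ℝ)).indicator (measurableSet_eq_fun hW' (hW.add_const 1))).condExp one_le_two

lemma memLp_upProb_div (hW : Measurable W) (hW' : Measurable W') (l : ℝ) :
    MemLp (fun ω => upProb P W W' ω / l) 2 P := by
  simpa only [div_eq_mul_inv] using (memLp_upProb hW hW').mul_const l⁻¹

variable {v : ℝ}

theorem IsExchangeablePair.dTV_map_translatedPoisson_le (h : IsExchangeablePair P W W')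
    (hreg : RegressionCondition P W W' μ l fun _ => 0) (hl : 0 < l)
    (hstep : ∀ᵐ ω ∂P, W' ω - W ω ∈ ({-1, 0, 1} : Set ℤ))
    (hW2 : MemLp (fun ω => (W ω : ℝ)) 2 P) (hvar : Var[fun ω => (W ω : ℝ); P] = v) (hv : 0 < v) :
    dTV (P.map W) (translatedPoisson μ v) ≤ √Var[upProb P W W'; P] / (l * v) + 2 / v := by
  refine ((isSteinCoefficient_upProb_div h hreg hl.ne' hstep hW2).dTV_map_translatedPoisson_le h.1
    hW2 (memLp_upProb_div h.1 h.2.1 l) hvar hv).trans_eq ?_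
  rw [variance_div_const, Real.sqrt_div' _ (sq_nonneg l), Real.sqrt_sq hl.le, div_div]

theorem IsExchangeablePair.dLoc_map_translatedPoisson_le (h : IsExchangeablePair P W W')
    (hreg : RegressionCondition P W W' μ l fun _ => 0) (hl : 0 < l)
    (hstep : ∀ᵐ ω ∂P, W' ω - W ω ∈ ({-1, 0, 1} : Set ℤ))
    (hW2 : MemLp (fun ω => (W ω : ℝ)) 2 P) (hvar : Var[fun ω => (W ω : ℝ); P] = v) (hv : 0 < v) :
    dLoc (P.map W) (translatedPoisson μ v) ≤
      2 * √(qMax (P.map W) * Var[upProb P W W'; P]) / (l * v) + 2 / v := by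
  refine ((isSteinCoefficient_upProb_div h hreg hl.ne' hstep hW2).dLoc_map_translatedPoisson_le h.1
    hW2 (memLp_upProb_div h.1 h.2.1 l) hvar hv).trans_eq ?_
  rw [variance_div_const, mul_div_assoc', Real.sqrt_div' _ (sq_nonneg l), Real.sqrt_sq hl.le,
    mul_div_assoc', div_div]

end ExchangeablePair

section BirthDeathPair

lemma condExp_compProd_comap_fst {α β : Type*} [MeasurableSpace α] [MeasurableSpace β]
    [StandardBorelSpace β] [Nonempty β] {ν : Measure α} [IsFiniteMeasure ν] {κ : Kernel α β}
    [IsMarkovKernel κ] {F : α × β → ℝ} (hF : Integrable F (ν ⊗ₘ κ)) :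
    (ν ⊗ₘ κ)[F | MeasurableSpace.comap Prod.fst inferInstance] =ᵐ[ν ⊗ₘ κ]
      fun x => ∫ y, F (x.1, y) ∂κ x.1 := by
  have hfst : (ν ⊗ₘ κ).map Prod.fst = ν := Measure.fst_compProd ν κ
  have hκ : condDistrib Prod.snd Prod.fst (ν ⊗ₘ κ) =ᵐ[(ν ⊗ₘ κ).map Prod.fst] κ :=
    condDistrib_ae_eq_of_measure_eq_compProd _ measurable_snd.aemeasurable
      (by simp only [hfst, Prod.mk.eta, Measure.map_id'])
  refine (condExp_prod_ae_eq_integral_condDistrib' (μ := ν ⊗ₘ κ) measurable_fst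
    measurable_snd.aemeasurable (by simpa using hF)).trans ?_
  filter_upwards [ae_of_ae_map measurable_fst.aemeasurable hκ] with x hx
  rw [hx]

lemma isExchangeablePair_compProd {ν : Measure ℤ} [IsFiniteMeasure ν] {κ : Kernel ℤ ℤ}
    [IsFiniteKernel κ]
    (h : ∀ i j, ν.real {i} * (κ i).real {j} = ν.real {j} * (κ j).real {i}) :
    IsExchangeablePair (ν ⊗ₘ κ) Prod.fst Prod.snd := by
  refine ⟨measurable_fst, measurable_snd, ?_⟩
  have hpoint : ∀ i j, (ν ⊗ₘ κ) {(i, j)} = ν {i} * κ i {j} := fun i j => by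
    rw [← Set.singleton_prod_singleton, Measure.compProd_apply_prod (.singleton i) (.singleton j),
      lintegral_singleton, mul_comm]
  have h' : ∀ i j, ν {i} * κ i {j} = ν {j} * κ j {i} := fun i j => by
    rw [← ENNReal.toReal_eq_toReal_iff' (by finiteness) (by finiteness), ENNReal.toReal_mul,
      ENNReal.toReal_mul]
    exact h i j
  refine Measure.ext_of_singleton fun ⟨i, j⟩ => ?_
  have hswap : (fun x : ℤ × ℤ => (x.2, x.1)) ⁻¹' {(i, j)} = {(j, i)} := by
    ext ⟨a, b⟩
    simp [and_comm]
  rw [Measure.map_apply (measurable_snd.prodMk measurable_fst) (.singleton _), hswap, hpoint]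
  simp only [Prod.mk.eta, Measure.map_id', hpoint, h' i j]

/-- The transition kernel of the birth–death chain on `ℤ` which moves from `k` to `k + 1` with
probability `b k` and to `k - 1` with probability `d k`. States at which `b k` and `d k` are not
such probabilities are made absorbing, so that this is always a Markov kernel. -/
noncomputable def birthDeathKernel (b d : ℤ → ℝ) : Kernel ℤ ℤ := open scoped Classical in
  Kernel.ofFunOfCountable fun k =>
    if 0 ≤ b k ∧ 0 ≤ d k ∧ b k + d k ≤ 1 then
      ENNReal.ofReal (b k) • Measure.dirac (k + 1) + ENNReal.ofReal (d k) • Measure.dirac (k - 1) +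
        ENNReal.ofReal (1 - b k - d k) • Measure.dirac k
    else Measure.dirac k

variable {b d : ℤ → ℝ} {ν : Measure ℤ} {μ l : ℝ}

instance isMarkovKernel_birthDeathKernel : IsMarkovKernel (birthDeathKernel b d) where
  isProbabilityMeasure k := by
    simp only [birthDeathKernel, Kernel.ofFunOfCountable, Kernel.coe_mk]
    split_ifs with h
    · constructor
      obtain ⟨hb, hd, hbd⟩ := h
      simp [← ENNReal.ofReal_add, hb, hd, add_nonneg, sub_sub, sub_nonneg.2 hbd]
    · infer_instance

lemma ae_birthDeathKernel (k : ℤ) :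
    ∀ᵐ j ∂birthDeathKernel b d k, j - k ∈ ({-1, 0, 1} : Set ℤ) := by
  simp only [birthDeathKernel, Kernel.ofFunOfCountable, Kernel.coe_mk]
  split_ifs
  · simp only [ae_add_measure_iff]
    refine ⟨⟨?_, ?_⟩, ?_⟩ <;> refine Measure.ae_smul_measure ?_ _ <;> simp [ae_dirac_eq]
  · simp [ae_dirac_eq]

lemma integral_birthDeathKernel {k : ℤ} (hk : 0 ≤ b k ∧ 0 ≤ d k ∧ b k + d k ≤ 1) (F : ℤ → ℝ) :
    ∫ j, F j ∂birthDeathKernel b d k =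
      b k * F (k + 1) + d k * F (k - 1) + (1 - b k - d k) * F k := by
  have hint : ∀ (c : ℝ) (x : ℤ), Integrable F (ENNReal.ofReal c • Measure.dirac x) := fun c x =>
    (integrable_dirac (by simp)).smul_measure ENNReal.ofReal_ne_top
  simp only [birthDeathKernel, Kernel.ofFunOfCountable, Kernel.coe_mk, if_pos hk]
  rw [integral_add_measure ((hint _ _).add_measure (hint _ _)) (hint _ _),
    integral_add_measure (hint _ _) (hint _ _)]
  simp only [integral_smul_measure, integral_dirac, smul_eq_mul]
  rw [ENNReal.toReal_ofReal hk.1, ENNReal.toReal_ofReal hk.2.1,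
    ENNReal.toReal_ofReal (by linarith)]

/-- The law on `ℤ × ℤ` of two consecutive states of the birth–death chain with rates `b` and `d`
started from `ν`. -/
noncomputable abbrev birthDeathPair (ν : Measure ℤ) (b d : ℤ → ℝ) : Measure (ℤ × ℤ) :=
  ν ⊗ₘ birthDeathKernel b d

lemma map_fst_birthDeathPair [SFinite ν] : (birthDeathPair ν b d).map Prod.fst = ν :=
  Measure.fst_compProd ν (birthDeathKernel b d)

lemma ae_birthDeathPair_snd_sub_fst_mem :
    ∀ᵐ x ∂birthDeathPair ν b d, x.2 - x.1 ∈ ({-1, 0, 1} : Set ℤ) :=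
  Measure.ae_compProd_of_ae_ae (.of_discrete) (.of_forall fun k => ae_birthDeathKernel k)

variable [IsFiniteMeasure ν]

lemma isExchangeablePair_birthDeathPair
    (hν : ∀ᵐ k ∂ν, 0 ≤ b k ∧ 0 ≤ d k ∧ b k + d k ≤ 1)
    (hbal : ∀ k, ν.real {k} * b k = ν.real {k + 1} * d (k + 1)) :
    IsExchangeablePair (birthDeathPair ν b d) Prod.fst Prod.snd := by
  have hpoint : ∀ i j, ν.real {i} * (birthDeathKernel b d i).real {j} = ν.real {i} *
      (b i * Set.indicator {j} 1 (i + 1) + d i * Set.indicator {j} 1 (i - 1) +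
        (1 - b i - d i) * Set.indicator {j} 1 i) := fun i j => by
    rcases eq_or_ne (ν {i}) 0 with hi | hi
    · simp [measureReal_def, hi]
    · rw [← integral_indicator_one (.singleton j),
        integral_birthDeathKernel (ae_iff_of_countable.1 hν i hi)]
  refine isExchangeablePair_compProd fun i j => ?_
  wlog hij : i ≤ j generalizing i j
  · exact (this j i (le_of_not_ge hij)).symm
  rw [hpoint, hpoint]
  obtain rfl | rfl | hij : i = j ∨ j = i + 1 ∨ i + 1 < j := by lia
  · rfl
  · simpa [Set.indicator_apply, sub_eq_add_neg, add_assoc] using hbal i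
  · have hne : i + 1 ≠ j ∧ i - 1 ≠ j ∧ i ≠ j ∧ j + 1 ≠ i ∧ j - 1 ≠ i ∧ j ≠ i := by lia
    simp [hne]

lemma condExp_birthDeathPair (hν : ∀ᵐ k ∂ν, 0 ≤ b k ∧ 0 ≤ d k ∧ b k + d k ≤ 1) {F : ℤ × ℤ → ℝ}
    (hF : Integrable F (birthDeathPair ν b d)) :
    (birthDeathPair ν b d)[F | MeasurableSpace.comap Prod.fst inferInstance]
      =ᵐ[birthDeathPair ν b d] fun x => b x.1 * F (x.1, x.1 + 1) + d x.1 * F (x.1, x.1 - 1) +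
        (1 - b x.1 - d x.1) * F (x.1, x.1) := by
  rw [← map_fst_birthDeathPair (ν := ν) (b := b) (d := d)] at hν
  filter_upwards [condExp_compProd_comap_fst hF, ae_of_ae_map measurable_fst.aemeasurable hν]
    with x hx hxbd
  exact hx.trans (integral_birthDeathKernel hxbd _)

lemma upProb_birthDeathPair (hν : ∀ᵐ k ∂ν, 0 ≤ b k ∧ 0 ≤ d k ∧ b k + d k ≤ 1) :
    upProb (birthDeathPair ν b d) Prod.fst Prod.snd =ᵐ[birthDeathPair ν b d] fun x => b x.1 := by
  refine (condExp_birthDeathPair hν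
    ((integrable_const (1 : ℝ)).indicator .of_discrete)).trans (.of_forall fun x => ?_)
  have hne : x.1 - 1 ≠ x.1 + 1 := by lia
  simp [hne]

lemma regressionCondition_birthDeathPair (hν : ∀ᵐ k ∂ν, 0 ≤ b k ∧ 0 ≤ d k ∧ b k + d k ≤ 1)
    (hint : Integrable (fun k : ℤ => (k : ℝ)) ν) (hdrift : ∀ k : ℤ, b k - d k = -l * (k - μ)) :
    RegressionCondition (birthDeathPair ν b d) Prod.fst Prod.snd μ l fun _ => 0 := by
  have hfst : Integrable (fun x : ℤ × ℤ => (x.1 : ℝ)) (birthDeathPair ν b d) := by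
    rw [← map_fst_birthDeathPair (ν := ν) (b := b) (d := d)] at hint
    exact hint.comp_measurable measurable_fst
  have hsnd : Integrable (fun x : ℤ × ℤ => (x.2 : ℝ)) (birthDeathPair ν b d) := by
    have hdiff : Integrable (fun x : ℤ × ℤ => ((x.2 - x.1 : ℤ) : ℝ)) (birthDeathPair ν b d) :=
      .of_bound .of_discrete 1 (ae_birthDeathPair_snd_sub_fst_mem.mono fun x hx => by
        rcases hx with hx | hx | (hx : _ = 1) <;> simp only [hx] <;> simp)
    simpa [Pi.add_def] using hfst.add hdiff
  refine (condExp_birthDeathPair hν (hsnd.sub (integrable_const μ))).trans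
    (.of_forall fun x => ?_)
  simp only [Pi.sub_apply]
  push_cast
  linear_combination hdrift x.1

end BirthDeathPair

section UnimodalLaw

variable {ν : Measure ℤ} [IsProbabilityMeasure ν] {c : ℝ}

lemma card_mul_le_one_of_forall_le_measureReal {s : Finset ℤ} {p : ℝ}
    (hp : ∀ k ∈ s, p ≤ ν.real {k}) : (s.card : ℝ) * p ≤ 1 :=
  calc (s.card : ℝ) * p ≤ ∑ k ∈ s, ν.real {k} := by
        simpa using s.card_nsmul_le_sum (fun k => ν.real {k}) p hp
    _ ≤ 1 := by
        rw [sum_measureReal_singleton]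
        exact measureReal_le_one

lemma abs_sub_mul_measureReal_singleton_le_one
    (hmono : ∀ k : ℤ, (k + 1 : ℝ) ≤ c → ν.real {k} ≤ ν.real {k + 1})
    (hanti : ∀ k : ℤ, c ≤ k → ν.real {k + 1} ≤ ν.real {k}) (k : ℤ) :
    |(k : ℝ) - c| * ν.real {k} ≤ 1 := by
  have hmono' : MonotoneOn (fun j => ν.real {j}) (Set.Iic ⌊c⌋) :=
    monotoneOn_of_le_add_one Set.ordConnected_Iic fun j _ _ hj =>
      hmono j (by exact_mod_cast Int.le_floor.1 hj)
  have hanti' : AntitoneOn (fun j => ν.real {j}) (Set.Ici ⌈c⌉) :=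
    antitoneOn_of_add_one_le Set.ordConnected_Ici fun j _ hj _ => hanti j (Int.ceil_le.1 hj)
  rcases le_total c k with hk | hk
  · have hcard : |(k : ℝ) - c| ≤ (Finset.Icc ⌈c⌉ k).card := by
      rw [abs_of_nonneg (sub_nonneg.2 hk), Int.card_Icc]
      have hle : ((k + 1 - ⌈c⌉ : ℤ) : ℝ) ≤ (k + 1 - ⌈c⌉).toNat := by
        exact_mod_cast Int.self_le_toNat _
      push_cast at hle
      linarith [Int.ceil_lt_add_one c]
    refine (mul_le_mul_of_nonneg_right hcard measureReal_nonneg).trans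
      (card_mul_le_one_of_forall_le_measureReal (ν := ν) fun j hj => ?_)
    rw [Finset.mem_Icc] at hj
    exact hanti' hj.1 (Int.ceil_le.2 hk) hj.2
  · have hcard : |(k : ℝ) - c| ≤ (Finset.Icc k ⌊c⌋).card := by
      rw [abs_of_nonpos (sub_nonpos.2 hk), Int.card_Icc]
      have hle : ((⌊c⌋ + 1 - k : ℤ) : ℝ) ≤ (⌊c⌋ + 1 - k).toNat := by
        exact_mod_cast Int.self_le_toNat _
      push_cast at hle
      linarith [Int.lt_floor_add_one c]
    refine (mul_le_mul_of_nonneg_right hcard measureReal_nonneg).trans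
      (card_mul_le_one_of_forall_le_measureReal (ν := ν) fun j hj => ?_)
    rw [Finset.mem_Icc] at hj
    exact hmono' (Int.le_floor.2 hk) hj.2 hj.1

end UnimodalLaw

section Hypergeometric

variable {m n N : ℕ}

lemma hypergeometric_real_natCast {k : ℕ} (hk : k ≤ m) :
    (hypergeometric m n N).real {(k : ℤ)} =
      (n.choose k : ℝ) * (N - n).choose (m - k) / N.choose m := by
  have hmem : k ∈ Finset.range (m + 1) := Finset.mem_range_succ_iff.2 hk
  rw [measureReal_def, hypergeometric, Measure.finsetSum_apply, Finset.sum_eq_single_of_mem k hmem]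
  · have hnonneg : (0 : ℝ) ≤ n.choose k * (N - n).choose (m - k) / N.choose m := by positivity
    simp [ENNReal.toReal_ofReal hnonneg]
  · intro j _ hj
    simp [hj]

instance isFiniteMeasure_hypergeometric : IsFiniteMeasure (hypergeometric m n N) where
  measure_univ_lt_top := by simp [hypergeometric, Measure.finsetSum_apply, ENNReal.sum_lt_top]

lemma hypergeometric_real_singleton_eq_zero {k : ℤ} (hk : k ∉ Set.Icc (0 : ℤ) m) :
    (hypergeometric m n N).real {k} = 0 := by
  rw [measureReal_eq_zero_iff, hypergeometric, Measure.finsetSum_apply]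
  refine Finset.sum_eq_zero fun j hj => ?_
  have hjk : (j : ℤ) ≠ k := by
    rintro rfl
    exact hk ⟨by lia, by exact_mod_cast Finset.mem_range_succ_iff.1 hj⟩
  simp [hjk]

lemma le_of_hypergeometric_singleton_ne_zero (hn : n ≤ N) {k : ℤ}
    (hk : hypergeometric m n N {k} ≠ 0) : 0 ≤ k ∧ k ≤ m ∧ k ≤ n ∧ m + n ≤ N + k := by
  have hreal : (hypergeometric m n N).real {k} ≠ 0 :=
    (measureReal_ne_zero_iff (by finiteness)).2 hk
  obtain ⟨hk0, hkm⟩ : k ∈ Set.Icc (0 : ℤ) m :=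
    Classical.not_not.1 (mt hypergeometric_real_singleton_eq_zero hreal)
  lift k to ℕ using hk0
  rw [Nat.cast_le] at hkm
  rw [hypergeometric_real_natCast hkm] at hreal
  have hkn : k ≤ n := by
    by_contra! hlt
    simp [Nat.choose_eq_zero_of_lt hlt] at hreal
  have hmk : m - k ≤ N - n := by
    by_contra! hlt
    simp [Nat.choose_eq_zero_of_lt hlt] at hreal
  lia

lemma isProbabilityMeasure_hypergeometric (hm : m ≤ N) (hn : n ≤ N) :
    IsProbabilityMeasure (hypergeometric m n N) := by
  have hchoose : (0 : ℝ) < N.choose m := by exact_mod_cast Nat.choose_pos hm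
  have hvandermonde : ∑ k ∈ Finset.range (m + 1), (n.choose k : ℝ) * (N - n).choose (m - k) =
      N.choose m := by
    have h := Nat.add_choose_eq n (N - n) m
    rw [Nat.add_sub_cancel' hn, Finset.Nat.sum_antidiagonal_eq_sum_range_succ_mk] at h
    exact_mod_cast h.symm
  constructor
  simp only [hypergeometric, Measure.finsetSum_apply, Measure.smul_apply, measure_univ,
    smul_eq_mul, mul_one]
  rw [← ENNReal.ofReal_sum_of_nonneg fun _ _ => by positivity, ← Finset.sum_div, hvandermonde,
    div_self hchoose.ne', ENNReal.ofReal_one]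

lemma natCast_choose_succ_mul (a k : ℕ) :
    (a.choose (k + 1) : ℝ) * (k + 1) = a.choose k * (a - k) := by
  rcases le_or_gt k a with hk | hk
  · rw [← Nat.cast_sub hk]
    exact_mod_cast Nat.choose_succ_right_eq a k
  · simp [Nat.choose_eq_zero_of_lt hk, Nat.choose_eq_zero_of_lt (hk.trans k.lt_succ_self)]

lemma hypergeometric_detailed_balance (hn : n ≤ N) (k : ℤ) :
    (hypergeometric m n N).real {k} * ((m - k) * (n - k)) =
      (hypergeometric m n N).real {k + 1} * ((k + 1) * (N - n - m + (k + 1))) := by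
  rcases lt_or_ge k 0 with hk0 | hk0
  · rw [hypergeometric_real_singleton_eq_zero fun h => hk0.not_ge h.1, zero_mul]
    obtain rfl | hk1 : k = -1 ∨ k + 1 < 0 := by lia
    · simp
    · rw [hypergeometric_real_singleton_eq_zero fun h => hk1.not_ge h.1, zero_mul]
  rcases le_or_gt (m : ℤ) k with hkm | hkm
  · rw [hypergeometric_real_singleton_eq_zero fun h => (Int.lt_add_one_iff.2 hkm).not_ge h.2,
      zero_mul]
    obtain rfl | hk1 := hkm.eq_or_lt
    · simp
    · rw [hypergeometric_real_singleton_eq_zero fun h => hk1.not_ge h.2, zero_mul]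
  lift k to ℕ using hk0
  obtain ⟨j, rfl⟩ : ∃ j, m = k + j + 1 := Nat.exists_eq_add_of_lt (by lia)
  have hup := natCast_choose_succ_mul n k
  have hdown := natCast_choose_succ_mul (N - n) j
  rw [Nat.cast_sub hn] at hdown
  rw [← Nat.cast_succ, hypergeometric_real_natCast (by lia), hypergeometric_real_natCast (by lia),
    div_mul_eq_mul_div, div_mul_eq_mul_div, show k + j + 1 - k = j + 1 by lia,
    show k + j + 1 - k.succ = j by lia]
  congr 1
  push_cast
  linear_combination (n.choose k : ℝ) * (n - k) * hdown -
    (N - n).choose j * ((N : ℝ) - n - j) * hup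

lemma ae_le_hypergeometric (hn : n ≤ N) : ∀ᵐ k : ℤ ∂hypergeometric m n N,
    (0 : ℝ) ≤ k ∧ (k : ℝ) ≤ m ∧ (k : ℝ) ≤ n ∧ (m + n : ℝ) ≤ N + k :=
  ae_iff_of_countable.2 fun _ hk => by
    exact_mod_cast le_of_hypergeometric_singleton_ne_zero hn hk

lemma memLp_two_hypergeometric (hn : n ≤ N) :
    MemLp (fun k : ℤ => (k : ℝ)) 2 (hypergeometric m n N) :=
  .of_bound .of_discrete m <| (ae_le_hypergeometric hn).mono fun k hk => by
    rw [Real.norm_of_nonneg hk.1]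
    exact hk.2.1

/-- The probability that the number `k` of balls in the first `n` of `N` urns increases when one of
the `m` balls, chosen uniformly at random, is moved to an urn chosen uniformly at random among the
`N - m + 1` urns not occupied by the other balls. -/
noncomputable def ballUpRate (m n N : ℕ) (k : ℤ) : ℝ :=
  (m - k) * (n - k) / (m * (N - m + 1))

/-- The probability that the number `k` of balls in the first `n` of `N` urns decreases under the
random move of one ball described at `ballUpRate`. -/
noncomputable def ballDownRate (m n N : ℕ) (k : ℤ) : ℝ :=
  k * (N - n - m + k) / (m * (N - m + 1))

/-- The joint law of the number of balls in the first `n` of `N` urns before and after the random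
move of one ball described at `ballUpRate`. -/
noncomputable abbrev ballPair (m n N : ℕ) : Measure (ℤ × ℤ) :=
  birthDeathPair (hypergeometric m n N) (ballUpRate m n N) (ballDownRate m n N)

lemma map_fst_ballPair : (ballPair m n N).map Prod.fst = hypergeometric m n N :=
  map_fst_birthDeathPair

/-- The Stein coefficient of `Hyp(m, n, N)`, namely the up-rate of the ball-moving chain divided by
its regression constant `N / (m (N - m + 1))`. -/
noncomputable def hypergeometricCoefficient (m n N : ℕ) (k : ℤ) : ℝ :=
  (m - k) * (n - k) / N

lemma natCast_mul_sub_add_one_pos (hm0 : 0 < m) (hm : m ≤ N) : (0 : ℝ) < m * (N - m + 1) := by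
  have hmN : (m : ℝ) ≤ N := by exact_mod_cast hm
  have hm0' : (0 : ℝ) < m := by exact_mod_cast hm0
  exact mul_pos hm0' (by linarith)

lemma ae_ballRates (hm0 : 0 < m) (hm : m ≤ N) (hn : n ≤ N) : ∀ᵐ k ∂hypergeometric m n N,
    0 ≤ ballUpRate m n N k ∧ 0 ≤ ballDownRate m n N k ∧
      ballUpRate m n N k + ballDownRate m n N k ≤ 1 := by
  have hpos := natCast_mul_sub_add_one_pos hm0 hm
  filter_upwards [ae_le_hypergeometric hn] with k ⟨hk0, hkm, hkn, hkN⟩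
  have hup : (0 : ℝ) ≤ m - k := sub_nonneg.2 hkm
  refine ⟨div_nonneg (mul_nonneg hup (by linarith)) hpos.le,
    div_nonneg (mul_nonneg hk0 (by linarith)) hpos.le, ?_⟩
  rw [ballUpRate, ballDownRate, ← add_div, div_le_one hpos]
  calc ((m : ℝ) - k) * (n - k) + k * (N - n - m + k)
      ≤ (m - k) * (N - m + 1) + k * (N - m + 1) :=
        add_le_add (mul_le_mul_of_nonneg_left (by linarith) hup)
          (mul_le_mul_of_nonneg_left (by linarith) hk0)
    _ = m * (N - m + 1) := by ring

lemma hypergeometric_real_mul_ballUpRate (hn : n ≤ N) (k : ℤ) :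
    (hypergeometric m n N).real {k} * ballUpRate m n N k =
      (hypergeometric m n N).real {k + 1} * ballDownRate m n N (k + 1) := by
  rw [ballUpRate, ballDownRate, ← mul_div_assoc, ← mul_div_assoc,
    hypergeometric_detailed_balance hn]
  push_cast
  rfl

lemma ballUpRate_sub_ballDownRate (hm0 : 0 < m) (hm : m ≤ N) (k : ℤ) :
    ballUpRate m n N k - ballDownRate m n N k =
      -((N : ℝ) / (m * (N - m + 1))) * (k - m * n / N) := by
  have hN : (N : ℝ) ≠ 0 := by exact_mod_cast (hm0.trans_le hm).ne'
  rw [ballUpRate, ballDownRate, ← sub_div, neg_mul, div_mul_eq_mul_div, ← neg_div]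
  congr 1
  field_simp
  ring

lemma isExchangeablePair_ballPair (hm0 : 0 < m) (hm : m ≤ N) (hn : n ≤ N) :
    IsExchangeablePair (ballPair m n N) Prod.fst Prod.snd :=
  isExchangeablePair_birthDeathPair (ae_ballRates hm0 hm hn) (hypergeometric_real_mul_ballUpRate hn)

lemma regressionCondition_ballPair (hm0 : 0 < m) (hm : m ≤ N) (hn : n ≤ N) :
    RegressionCondition (ballPair m n N) Prod.fst Prod.snd (m * n / N)
      ((N : ℝ) / (m * (N - m + 1))) fun _ => 0 :=
  regressionCondition_birthDeathPair (ae_ballRates hm0 hm hn)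
    ((memLp_two_hypergeometric hn).integrable one_le_two) (ballUpRate_sub_ballDownRate hm0 hm)

lemma memLp_two_fst_ballPair (hn : n ≤ N) :
    MemLp (fun x : ℤ × ℤ => (x.1 : ℝ)) 2 (ballPair m n N) := by
  have h := memLp_two_hypergeometric (m := m) hn
  rw [← map_fst_ballPair] at h
  exact h.comp_of_map measurable_fst.aemeasurable

lemma upProb_ballPair (hm0 : 0 < m) (hm : m ≤ N) (hn : n ≤ N) :
    upProb (ballPair m n N) Prod.fst Prod.snd =ᵐ[ballPair m n N] fun x =>
      (N : ℝ) / (m * (N - m + 1)) * hypergeometricCoefficient m n N x.1 := by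
  have hN : (N : ℝ) ≠ 0 := by exact_mod_cast (hm0.trans_le hm).ne'
  refine (upProb_birthDeathPair (ae_ballRates hm0 hm hn)).trans (.of_forall fun x => ?_)
  simp only [ballUpRate, hypergeometricCoefficient]
  field_simp

lemma isSteinCoefficient_hypergeometric (hm0 : 0 < m) (hm : m ≤ N) (hn : n ≤ N) :
    IsSteinCoefficient (hypergeometric m n N) id (m * n / N) (hypergeometricCoefficient m n N) := by
  have := isProbabilityMeasure_hypergeometric hm hn
  have hN : (0 : ℝ) < N := by exact_mod_cast hm0.trans_le hm
  have hl : (N : ℝ) / (m * (N - m + 1)) ≠ 0 :=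
    (div_pos hN (natCast_mul_sub_add_one_pos hm0 hm)).ne'
  have hpair := isSteinCoefficient_upProb_div (isExchangeablePair_ballPair hm0 hm hn)
    (regressionCondition_ballPair hm0 hm hn) hl ae_birthDeathPair_snd_sub_fst_mem
    (memLp_two_fst_ballPair hn)
  have h := hpair.map_id_of_ae_eq_comp measurable_fst (τ := hypergeometricCoefficient m n N)
    ((upProb_ballPair hm0 hm hn).mono fun x hx => by
      simp only [hx]
      exact mul_div_cancel_left₀ _ hl)
  rwa [map_fst_ballPair] at h

lemma lawMean_hypergeometric (hm0 : 0 < m) (hm : m ≤ N) (hn : n ≤ N) :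
    lawMean (hypergeometric m n N) = m * n / N :=
  have := isProbabilityMeasure_hypergeometric hm hn
  (isSteinCoefficient_hypergeometric hm0 hm hn).integral_eq
    ((memLp_two_hypergeometric hn).integrable one_le_two)

lemma ae_hypergeometricCoefficient_mem_Icc (hm : m ≤ N) (hn : n ≤ N) :
    ∀ᵐ k ∂hypergeometric m n N, hypergeometricCoefficient m n N k ∈ Set.Icc (0 : ℝ) N := by
  filter_upwards [ae_le_hypergeometric hn] with k ⟨hk0, hkm, hkn, _⟩
  have hmk : (0 : ℝ) ≤ m - k := sub_nonneg.2 hkm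
  have hnk : (0 : ℝ) ≤ n - k := sub_nonneg.2 hkn
  have hmkN : (m : ℝ) - k ≤ N := (sub_le_self _ hk0).trans (by exact_mod_cast hm)
  have hnkN : (n : ℝ) - k ≤ N := (sub_le_self _ hk0).trans (by exact_mod_cast hn)
  exact ⟨div_nonneg (mul_nonneg hmk hnk) N.cast_nonneg,
    div_le_of_le_mul₀ N.cast_nonneg N.cast_nonneg (mul_le_mul hmkN hnkN hnk N.cast_nonneg)⟩

lemma memLp_hypergeometricCoefficient (hm : m ≤ N) (hn : n ≤ N) (p : ENNReal) :
    MemLp (hypergeometricCoefficient m n N) p (hypergeometric m n N) :=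
  .of_bound .of_discrete N <| (ae_hypergeometricCoefficient_mem_Icc hm hn).mono fun k hk => by
    rw [Real.norm_of_nonneg hk.1]
    exact hk.2

lemma integral_hypergeometricCoefficient (hm0 : 0 < m) (hm : m ≤ N) (hn : n ≤ N) :
    ∫ k, hypergeometricCoefficient m n N k ∂hypergeometric m n N =
      lawVar (hypergeometric m n N) :=
  have := isProbabilityMeasure_hypergeometric hm hn
  (isSteinCoefficient_hypergeometric hm0 hm hn).integral_coefficient_eq_variance
    (memLp_two_hypergeometric hn)

lemma lawVar_hypergeometric_le (hm0 : 0 < m) (hm : m ≤ N) (hn : n ≤ N) :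
    lawVar (hypergeometric m n N) ≤ N := by
  have := isProbabilityMeasure_hypergeometric hm hn
  rw [← integral_hypergeometricCoefficient hm0 hm hn]
  refine (integral_mono_ae ((memLp_hypergeometricCoefficient hm hn 1).integrable le_rfl)
    (integrable_const (N : ℝ))
    ((ae_hypergeometricCoefficient_mem_Icc hm hn).mono fun _ hk => hk.2)).trans_eq ?_
  simp

/-- `E[(m - W)(n - W)]` evaluated in two ways. -/
lemma natCast_mul_lawVar_hypergeometric (hm0 : 0 < m) (hm : m ≤ N) (hn : n ≤ N) :
    N * lawVar (hypergeometric m n N) =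
      ((m : ℝ) - m * n / N) * (n - m * n / N) + lawVar (hypergeometric m n N) := by
  have := isProbabilityMeasure_hypergeometric hm hn
  have hN : (N : ℝ) ≠ 0 := by exact_mod_cast (hm0.trans_le hm).ne'
  have hL2 := memLp_two_hypergeometric (m := m) hn
  have hmean : ∫ k : ℤ, (k : ℝ) ∂hypergeometric m n N = m * n / N :=
    lawMean_hypergeometric hm0 hm hn
  have hsq : ∫ k : ℤ, (k : ℝ) ^ 2 ∂hypergeometric m n N =
      lawVar (hypergeometric m n N) + (m * n / N : ℝ) ^ 2 := by
    rw [lawVar, variance_eq_sub hL2, hmean, sub_add_cancel]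
    rfl
  have hprod : ∫ k : ℤ, ((m : ℝ) - k) * (n - k) ∂hypergeometric m n N =
      m * n - (m + n) * (m * n / N) + (lawVar (hypergeometric m n N) + (m * n / N : ℝ) ^ 2) := by
    have hlin := (hL2.integrable one_le_two).const_mul (m + n : ℝ)
    have hsub : Integrable (fun k : ℤ => (m * n - (m + n) * k : ℝ)) (hypergeometric m n N) :=
      (integrable_const _).sub hlin
    have hexpand : ∀ k : ℤ, ((m : ℝ) - k) * (n - k) = m * n - (m + n) * k + (k : ℝ) ^ 2 :=
      fun k => by ring
    simp only [hexpand]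
    rw [integral_add hsub hL2.integrable_sq, integral_sub (integrable_const _) hlin,
      integral_const_mul (m + n : ℝ), hmean, hsq]
    simp
  nth_rw 1 [← integral_hypergeometricCoefficient hm0 hm hn]
  simp only [hypergeometricCoefficient]
  rw [integral_div, hprod, mul_div_cancel₀ _ hN]
  ring

theorem lawVar_hypergeometric (hm0 : 0 < m) (hm : m ≤ N) (hn : n ≤ N) (hN : N ≠ 1) :
    lawVar (hypergeometric m n N) =
      (n : ℝ) * m * ((N : ℝ) - n) * ((N : ℝ) - m) / (((N : ℝ) - 1) * (N : ℝ) ^ 2) := by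
  have hN0 : (N : ℝ) ≠ 0 := by exact_mod_cast (hm0.trans_le hm).ne'
  have hN1 : (N : ℝ) - 1 ≠ 0 := sub_ne_zero.2 (by exact_mod_cast hN)
  have h := natCast_mul_lawVar_hypergeometric hm0 hm hn
  field_simp at h ⊢
  linear_combination h

lemma hypergeometricCoefficient_sub_lawVar (hm0 : 0 < m) (hm : m ≤ N) (hn : n ≤ N) (k : ℤ) :
    hypergeometricCoefficient m n N k - lawVar (hypergeometric m n N) =
      (k - m * n / N) * (k + m * n / N - (m + n)) / N - lawVar (hypergeometric m n N) / N := by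
  have hN : (N : ℝ) ≠ 0 := by exact_mod_cast (hm0.trans_le hm).ne'
  rw [hypergeometricCoefficient, div_sub' hN, natCast_mul_lawVar_hypergeometric hm0 hm hn]
  ring

lemma abs_add_mean_sub_le (hm : m ≤ N) {k : ℝ} (hk0 : 0 ≤ k) (hkm : k ≤ m) :
    |k + m * n / N - (m + n)| ≤ m + n := by
  have hmean0 : (0 : ℝ) ≤ m * n / N := by positivity
  have hmean : (m * n / N : ℝ) ≤ n :=
    div_le_of_le_mul₀ N.cast_nonneg n.cast_nonneg (by rw [mul_comm]; gcongr)
  rw [abs_of_nonpos (by linarith)]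
  linarith

lemma variance_hypergeometricCoefficient_le (hm0 : 0 < m) (hm : m ≤ N) (hn : n ≤ N) :
    Var[hypergeometricCoefficient m n N; hypergeometric m n N] ≤
      ((m + n) / N : ℝ) ^ 2 * lawVar (hypergeometric m n N) := by
  have := isProbabilityMeasure_hypergeometric hm hn
  set v := lawVar (hypergeometric m n N) with hv
  have hsub (k : ℤ) : hypergeometricCoefficient m n N k - (v - v / N) =
      (k + m * n / N - (m + n)) / N * (k - m * n / N) := by
    linear_combination hypergeometricCoefficient_sub_lawVar hm0 hm hn k
  have hbound : ∀ᵐ k : ℤ ∂hypergeometric m n N,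
      ((k + m * n / N - (m + n)) / N * (k - m * n / N) : ℝ) ^ 2 ≤
        ((m + n) / N : ℝ) ^ 2 * (k - m * n / N) ^ 2 := by
    filter_upwards [ae_le_hypergeometric hn] with k ⟨hk0, hkm, _, _⟩
    rw [mul_pow, div_pow, div_pow]
    refine mul_le_mul_of_nonneg_right (div_le_div_of_nonneg_right ?_ (sq_nonneg _)) (sq_nonneg _)
    exact sq_le_sq.2 ((abs_add_mean_sub_le hm hk0 hkm).trans (le_abs_self _))
  have hint : Integrable (fun k : ℤ => ((k : ℝ) - m * n / N) ^ 2) (hypergeometric m n N) :=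
    ((memLp_two_hypergeometric hn).sub (memLp_const _)).integrable_sq
  calc Var[hypergeometricCoefficient m n N; hypergeometric m n N]
      = Var[fun k => hypergeometricCoefficient m n N k - (v - v / N); hypergeometric m n N] :=
        (variance_sub_const .of_discrete _).symm
    _ ≤ ∫ k, (hypergeometricCoefficient m n N k - (v - v / N)) ^ 2 ∂hypergeometric m n N :=
        variance_le_expectation_sq .of_discrete
    _ ≤ ∫ k : ℤ, ((m + n) / N : ℝ) ^ 2 * (k - m * n / N) ^ 2 ∂hypergeometric m n N := by
        simp only [hsub]
        exact integral_mono_of_nonneg (.of_forall fun _ => sq_nonneg _) (hint.const_mul _) hbound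
    _ = ((m + n) / N : ℝ) ^ 2 * v := by
        rw [integral_const_mul, hv, lawVar, variance_eq_integral .of_discrete,
          ← lawMean_hypergeometric hm0 hm hn, lawMean]

lemma variance_upProb_ballPair (hm0 : 0 < m) (hm : m ≤ N) (hn : n ≤ N) :
    Var[upProb (ballPair m n N) Prod.fst Prod.snd; ballPair m n N] =
      ((N : ℝ) / (m * (N - m + 1))) ^ 2 *
        Var[hypergeometricCoefficient m n N; hypergeometric m n N] := by
  rw [variance_congr (upProb_ballPair hm0 hm hn), variance_const_mul]
  rw [← map_fst_ballPair, variance_map .of_discrete measurable_fst.aemeasurable]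
  rfl

lemma variance_upProb_ballPair_le (hm0 : 0 < m) (hm : m ≤ N) (hn : n ≤ N) (hN : N ≠ 1) :
    Var[upProb (ballPair m n N) Prod.fst Prod.snd; ballPair m n N] ≤
      ((n : ℝ) * m * ((m : ℝ) + n) ^ 2 * ((N : ℝ) - n) * ((N : ℝ) - m)) /
        ((m : ℝ) ^ 2 * ((N : ℝ) - m + 1) ^ 2 * ((N : ℝ) - 1) * (N : ℝ) ^ 2) := by
  have hN0 : (N : ℝ) ≠ 0 := by exact_mod_cast (hm0.trans_le hm).ne'
  rw [variance_upProb_ballPair hm0 hm hn]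
  refine (mul_le_mul_of_nonneg_left (variance_hypergeometricCoefficient_le hm0 hm hn)
    (sq_nonneg _)).trans_eq ?_
  rw [lawVar_hypergeometric hm0 hm hn hN]
  field_simp

lemma lawVar_hypergeometric_pos (hm0 : 0 < m) (hm : m < N) (hn0 : 0 < n) (hn : n < N) :
    0 < lawVar (hypergeometric m n N) := by
  have hm' : (0 : ℝ) < N - m := sub_pos.2 (by exact_mod_cast hm)
  have hn' : (0 : ℝ) < N - n := sub_pos.2 (by exact_mod_cast hn)
  have hN : (0 : ℝ) < N - 1 := sub_pos.2 (by exact_mod_cast (Nat.succ_le_of_lt hm0).trans_lt hm)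
  have hN0 : 0 < N := by lia
  rw [lawVar_hypergeometric hm0 hm.le hn.le (by lia)]
  positivity

lemma regressionConstant_pos (hm0 : 0 < m) (hm : m ≤ N) : 0 < (N : ℝ) / (m * (N - m + 1)) :=
  div_pos (by exact_mod_cast hm0.trans_le hm) (natCast_mul_sub_add_one_pos hm0 hm)

lemma regressionConstant_lt_one (hm2 : 2 ≤ m) (hm : m < N) :
    (N : ℝ) / (m * (N - m + 1)) < 1 := by
  have hm2' : (2 : ℝ) ≤ m := by exact_mod_cast hm2
  have hm' : (m : ℝ) + 1 ≤ N := by exact_mod_cast hm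
  rw [div_lt_one (natCast_mul_sub_add_one_pos (by lia) hm.le)]
  nlinarith [mul_pos (show (0 : ℝ) < m - 1 by linarith) (show (0 : ℝ) < N - m by linarith)]

lemma variance_fst_ballPair :
    Var[fun x : ℤ × ℤ => (x.1 : ℝ); ballPair m n N] = lawVar (hypergeometric m n N) := by
  rw [lawVar, ← map_fst_ballPair, variance_map .of_discrete measurable_fst.aemeasurable]
  rfl

theorem dTV_hypergeometric_matchingTP_le_ballPair (hm0 : 0 < m) (hm : m ≤ N) (hn : n ≤ N)
    (hv : 0 < lawVar (hypergeometric m n N)) :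
    dTV (hypergeometric m n N) (matchingTP (hypergeometric m n N)) ≤
      √Var[upProb (ballPair m n N) Prod.fst Prod.snd; ballPair m n N] /
        (N / (m * (N - m + 1)) * lawVar (hypergeometric m n N)) +
        2 / lawVar (hypergeometric m n N) := by
  have := isProbabilityMeasure_hypergeometric hm hn
  have h := (isExchangeablePair_ballPair hm0 hm hn).dTV_map_translatedPoisson_le
    (regressionCondition_ballPair hm0 hm hn) (regressionConstant_pos hm0 hm)
    ae_birthDeathPair_snd_sub_fst_mem (memLp_two_fst_ballPair hn) variance_fst_ballPair hv
  rwa [map_fst_ballPair, ← lawMean_hypergeometric hm0 hm hn] at h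

theorem dLoc_hypergeometric_matchingTP_le_ballPair (hm0 : 0 < m) (hm : m ≤ N) (hn : n ≤ N)
    (hv : 0 < lawVar (hypergeometric m n N)) :
    dLoc (hypergeometric m n N) (matchingTP (hypergeometric m n N)) ≤
      2 * √(qMax (hypergeometric m n N) *
          Var[upProb (ballPair m n N) Prod.fst Prod.snd; ballPair m n N]) /
        (N / (m * (N - m + 1)) * lawVar (hypergeometric m n N)) +
        2 / lawVar (hypergeometric m n N) := by
  have := isProbabilityMeasure_hypergeometric hm hn
  have h := (isExchangeablePair_ballPair hm0 hm hn).dLoc_map_translatedPoisson_le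
    (regressionCondition_ballPair hm0 hm hn) (regressionConstant_pos hm0 hm)
    ae_birthDeathPair_snd_sub_fst_mem (memLp_two_fst_ballPair hn) variance_fst_ballPair hv
  rwa [map_fst_ballPair, ← lawMean_hypergeometric hm0 hm hn] at h

lemma hypergeometric_real_singleton_le_succ (hm0 : 0 < m) (hm : m ≤ N) (hn : n ≤ N) {k : ℤ}
    (hk : (k + 1 : ℝ) ≤ m * n / N) :
    (hypergeometric m n N).real {k} ≤ (hypergeometric m n N).real {k + 1} := by
  have hN : (0 : ℝ) < N := by exact_mod_cast hm0.trans_le hm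
  have hm' : (m : ℝ) ≤ N := by exact_mod_cast hm
  have hn' : (n : ℝ) ≤ N := by exact_mod_cast hn
  rw [le_div_iff₀ hN] at hk
  have hkm : (k + 1 : ℝ) ≤ m := by nlinarith
  have hkn : (k + 1 : ℝ) ≤ n := by nlinarith
  have hup : (0 : ℝ) < (m - k) * (n - k) := by nlinarith
  refine le_of_mul_le_mul_right ?_ hup
  rw [hypergeometric_detailed_balance hn]
  refine mul_le_mul_of_nonneg_left ?_ measureReal_nonneg
  nlinarith

lemma hypergeometric_real_singleton_succ_le (hm0 : 0 < m) (hm : m ≤ N) (hn : n ≤ N) {k : ℤ}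
    (hk : (m * n / N : ℝ) ≤ k) :
    (hypergeometric m n N).real {k + 1} ≤ (hypergeometric m n N).real {k} := by
  have hN : (0 : ℝ) < N := by exact_mod_cast hm0.trans_le hm
  have hm' : (m : ℝ) ≤ N := by exact_mod_cast hm
  have hn' : (n : ℝ) ≤ N := by exact_mod_cast hn
  have hk0 : (0 : ℝ) ≤ k := le_trans (by positivity) hk
  have hgap : (0 : ℝ) ≤ N - n - m + k := by
    have hmean : (N - n - m + m * n / N : ℝ) = (N - n) * (N - m) / N := by
      field_simp
      ring
    have hnonneg : (0 : ℝ) ≤ (N - n) * (N - m) / N :=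
      div_nonneg (mul_nonneg (sub_nonneg.2 hn') (sub_nonneg.2 hm')) hN.le
    linarith
  rw [div_le_iff₀ hN] at hk
  have hdown : (0 : ℝ) < (k + 1) * (N - n - m + (k + 1)) := by nlinarith
  refine le_of_mul_le_mul_right ?_ hdown
  rw [← hypergeometric_detailed_balance hn]
  refine mul_le_mul_of_nonneg_left ?_ measureReal_nonneg
  nlinarith

lemma abs_sub_mean_mul_hypergeometric_real_singleton_le_one (hm0 : 0 < m) (hm : m ≤ N)
    (hn : n ≤ N) (k : ℤ) :
    |(k : ℝ) - m * n / N| * (hypergeometric m n N).real {k} ≤ 1 :=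
  have := isProbabilityMeasure_hypergeometric hm hn
  abs_sub_mul_measureReal_singleton_le_one
    (fun _ => hypergeometric_real_singleton_le_succ hm0 hm hn)
    (fun _ => hypergeometric_real_singleton_succ_le hm0 hm hn) k

lemma hypergeometric_real_mul_abs_coefficient_sub_lawVar_le (hm0 : 0 < m) (hm : m ≤ N)
    (hn : n ≤ N) (k : ℤ) :
    (hypergeometric m n N).real {k} *
      |hypergeometricCoefficient m n N k - lawVar (hypergeometric m n N)| ≤ 3 := by
  have := isProbabilityMeasure_hypergeometric hm hn
  rcases eq_or_ne (hypergeometric m n N {k}) 0 with hk | hk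
  · simp [measureReal_def, hk]
  obtain ⟨hk0, hkm, _, _⟩ := ae_iff_of_countable.1 (ae_le_hypergeometric hn) k hk
  have hN : (0 : ℝ) < N := by exact_mod_cast hm0.trans_le hm
  have hm' : (m : ℝ) ≤ N := by exact_mod_cast hm
  have hn' : (n : ℝ) ≤ N := by exact_mod_cast hn
  have hv0 : 0 ≤ lawVar (hypergeometric m n N) := variance_nonneg _ _
  have hgap : |hypergeometricCoefficient m n N k - lawVar (hypergeometric m n N)| ≤
      2 * |(k : ℝ) - m * n / N| + 1 := by
    rw [hypergeometricCoefficient_sub_lawVar hm0 hm hn]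
    refine (abs_sub _ _).trans (add_le_add ?_ ?_)
    · rw [abs_div, abs_mul, abs_of_pos hN, div_le_iff₀ hN]
      have hfactor := (abs_add_mean_sub_le hm hk0 hkm).trans (add_le_add hm' hn')
      exact (mul_le_mul_of_nonneg_left hfactor (abs_nonneg _)).trans_eq (by ring)
    · rw [abs_of_nonneg (by positivity), div_le_one hN]
      exact lawVar_hypergeometric_le hm0 hm hn
  have hunimodal := abs_sub_mean_mul_hypergeometric_real_singleton_le_one hm0 hm hn k
  have hle : (hypergeometric m n N).real {k} ≤ 1 := measureReal_le_one
  refine (mul_le_mul_of_nonneg_left hgap measureReal_nonneg).trans ?_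
  linarith

lemma hypergeometric_zero_balls : hypergeometric 0 n N = Measure.dirac 0 := by
  simp [hypergeometric]

lemma pos_of_lawVar_hypergeometric_pos (hv : 0 < lawVar (hypergeometric m n N)) : 0 < m := by
  rw [Nat.pos_iff_ne_zero]
  rintro rfl
  simp [lawVar, hypergeometric_zero_balls] at hv

theorem dTV_hypergeometric_matchingTP_le (hm : m ≤ N) (hn : n ≤ N)
    (hv : 0 < lawVar (hypergeometric m n N)) :
    dTV (hypergeometric m n N) (matchingTP (hypergeometric m n N)) ≤
      2 / √(lawVar (hypergeometric m n N)) + 2 / lawVar (hypergeometric m n N) := by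
  have hm0 := pos_of_lawVar_hypergeometric_pos hv
  have := isProbabilityMeasure_hypergeometric hm hn
  have hstein := (isSteinCoefficient_hypergeometric hm0 hm hn).dTV_map_translatedPoisson_le
    measurable_id (memLp_two_hypergeometric hn) (memLp_hypergeometricCoefficient hm hn 2) rfl hv
  rw [Measure.map_id, ← lawMean_hypergeometric hm0 hm hn] at hstein
  refine hstein.trans ?_
  set v := lawVar (hypergeometric m n N)
  have hratio : ((m + n) / N : ℝ) ≤ 2 := by
    have hm' : (m : ℝ) ≤ N := by exact_mod_cast hm
    have hn' : (n : ℝ) ≤ N := by exact_mod_cast hn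
    exact div_le_of_le_mul₀ N.cast_nonneg zero_le_two (by linarith)
  have hvar : Var[hypergeometricCoefficient m n N; hypergeometric m n N] ≤ 2 ^ 2 * v :=
    (variance_hypergeometricCoefficient_le hm0 hm hn).trans (by gcongr)
  refine add_le_add_left ?_ _
  calc √Var[hypergeometricCoefficient m n N; hypergeometric m n N] / v
      ≤ √(2 ^ 2 * v) / v := by gcongr
    _ = 2 / √v := by
        rw [Real.sqrt_mul (by positivity), Real.sqrt_sq zero_le_two, mul_div_assoc,
          Real.sqrt_div_self']
        ring

theorem dLoc_hypergeometric_matchingTP_le (hm : m ≤ N) (hn : n ≤ N)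
    (hv : 0 < lawVar (hypergeometric m n N)) :
    dLoc (hypergeometric m n N) (matchingTP (hypergeometric m n N)) ≤
      8 / lawVar (hypergeometric m n N) := by
  have hm0 := pos_of_lawVar_hypergeometric_pos hv
  have := isProbabilityMeasure_hypergeometric hm hn
  rw [matchingTP, lawMean_hypergeometric hm0 hm hn]
  have hstein := isSteinCoefficient_hypergeometric hm0 hm hn
  refine (hstein.dLoc_translatedPoisson_le_of_forall_mul_abs_le (memLp_two_hypergeometric hn)
    ((memLp_hypergeometricCoefficient hm hn 1).integrable le_rfl) rfl hv
    (hypergeometric_real_mul_abs_coefficient_sub_lawVar_le hm0 hm hn)).trans_eq ?_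
  norm_num

end Hypergeometric

section Asymptotics

lemma dTV_nonneg (P Q : Measure ℤ) : 0 ≤ dTV P Q := Real.iSup_nonneg fun _ => abs_nonneg _

lemma dLoc_nonneg (P Q : Measure ℤ) : 0 ≤ dLoc P Q := Real.iSup_nonneg fun _ => abs_nonneg _

lemma inv_isBigO_inv_natCast {v : ℕ → ℝ} (hv : (fun n : ℕ => (n : ℝ)) =O[atTop] v) :
    (fun n => (v n)⁻¹) =O[atTop] fun n : ℕ => (n : ℝ)⁻¹ :=
  hv.inv_rev <| (eventually_ne_atTop 0).mono fun _ hn h => absurd h (Nat.cast_ne_zero.2 hn)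

lemma inv_sqrt_isBigO_rpow_neg_half {v : ℕ → ℝ} (hv : (fun n : ℕ => (n : ℝ)) =O[atTop] v) :
    (fun n => (√(v n))⁻¹) =O[atTop] fun n : ℕ => (n : ℝ) ^ (-(1 / 2) : ℝ) := by
  refine ((inv_isBigO_inv_natCast hv).rpow (by norm_num : (0 : ℝ) ≤ 1 / 2)
    (.of_forall fun _ => by positivity)).congr (fun _ => ?_) fun n => ?_
  · rw [← Real.sqrt_eq_rpow, Real.sqrt_inv]
  · rw [Real.inv_rpow n.cast_nonneg, Real.rpow_neg n.cast_nonneg]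

lemma inv_natCast_isBigO_rpow_neg_half :
    (fun n : ℕ => (n : ℝ)⁻¹) =O[atTop] fun n : ℕ => (n : ℝ) ^ (-(1 / 2) : ℝ) := by
  refine .of_norm_eventuallyLE ?_
  filter_upwards [eventually_ge_atTop 1] with n hn
  rw [Real.norm_of_nonneg (by positivity), ← Real.rpow_neg_one]
  exact Real.rpow_le_rpow_of_exponent_le (by exact_mod_cast hn) (by norm_num)

lemma eventually_lawVar_pos {v : ℕ → ℝ} (hv0 : ∀ n, 0 ≤ v n)
    (hv : (fun n : ℕ => (n : ℝ)) =O[atTop] v) : ∀ᶠ n in atTop, 0 < v n := by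
  filter_upwards [hv.eq_zero_imp, eventually_ne_atTop 0] with n hn hne
  exact (hv0 n).lt_of_ne' fun h => hne (Nat.cast_eq_zero.1 (hn h))

variable {N m : ℕ → ℕ}

theorem isBigO_dTV_hypergeometric_matchingTP (hn : ∀ᶠ n in atTop, n ≤ N n)
    (hm : ∀ᶠ n in atTop, m n ≤ N n)
    (hv : (fun n : ℕ => (n : ℝ)) =O[atTop] fun n => lawVar (hypergeometric (m n) n (N n))) :
    (fun n => dTV (hypergeometric (m n) n (N n)) (matchingTP (hypergeometric (m n) n (N n))))
      =O[atTop] fun n : ℕ => (n : ℝ) ^ (-(1 / 2) : ℝ) := by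
  have hv0 (n : ℕ) : 0 ≤ lawVar (hypergeometric (m n) n (N n)) := variance_nonneg _ _
  have hsqrt := inv_sqrt_isBigO_rpow_neg_half hv
  have hinv := (inv_isBigO_inv_natCast hv).trans inv_natCast_isBigO_rpow_neg_half
  refine .trans (.of_norm_eventuallyLE ?_) ((hsqrt.const_mul_left 2).add (hinv.const_mul_left 2))
  filter_upwards [hn, hm, eventually_lawVar_pos hv0 hv] with n hn hm hv
  rw [Real.norm_of_nonneg (dTV_nonneg _ _)]
  simpa only [div_eq_mul_inv] using dTV_hypergeometric_matchingTP_le hm hn hv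

theorem isBigO_dLoc_hypergeometric_matchingTP (hn : ∀ᶠ n in atTop, n ≤ N n)
    (hm : ∀ᶠ n in atTop, m n ≤ N n)
    (hv : (fun n : ℕ => (n : ℝ)) =O[atTop] fun n => lawVar (hypergeometric (m n) n (N n))) :
    (fun n => dLoc (hypergeometric (m n) n (N n)) (matchingTP (hypergeometric (m n) n (N n))))
      =O[atTop] fun n : ℕ => (n : ℝ)⁻¹ := by
  have hv0 (n : ℕ) : 0 ≤ lawVar (hypergeometric (m n) n (N n)) := variance_nonneg _ _
  refine .trans (.of_norm_eventuallyLE ?_) ((inv_isBigO_inv_natCast hv).const_mul_left 8)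
  filter_upwards [hn, hm, eventually_lawVar_pos hv0 hv] with n hn hm hv
  rw [Real.norm_of_nonneg (dLoc_nonneg _ _), ← div_eq_mul_inv]
  exact dLoc_hypergeometric_matchingTP_le hm hn hv

end Asymptotics

theorem theorem4p2_general :
    (∀ m n N : ℕ, 0 < m → m < N → 0 < n → n < N →
      ∀ (ν : Measure ℤ) (μ v l : ℝ), ν = hypergeometric m n N → μ = lawMean ν → v = lawVar ν →
        l = (N : ℝ) / ((m : ℝ) * ((N : ℝ) - m + 1)) →
      v = (n : ℝ) * m * ((N : ℝ) - n) * ((N : ℝ) - m) / (((N : ℝ) - 1) * (N : ℝ) ^ 2) ∧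
      0 < l ∧ (2 ≤ m → l < 1) ∧
      ∃ (Ω : Type) (_ : MeasurableSpace Ω) (P : Measure Ω) (W W' : Ω → ℤ),
        IsProbabilityMeasure P ∧ P.map W = ν ∧
        IsExchangeablePair P W W' ∧
        RegressionCondition P W W' μ l (fun _ => 0) ∧
        (∀ᵐ ω ∂P, W' ω - W ω ∈ ({-1, 0, 1} : Set ℤ)) ∧
        dTV ν (translatedPoisson μ v)
          ≤ √(Var[upProb P W W'; P]) / (l * v) + 2 / v ∧
        dLoc ν (translatedPoisson μ v)
          ≤ 2 * √(qMax ν * Var[upProb P W W'; P]) / (l * v) + 2 / v ∧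
        Var[upProb P W W'; P]
          ≤ ((n : ℝ) * m * ((m : ℝ) + n) ^ 2 * ((N : ℝ) - n) * ((N : ℝ) - m)) /
            ((m : ℝ) ^ 2 * ((N : ℝ) - m + 1) ^ 2 * ((N : ℝ) - 1) * (N : ℝ) ^ 2)) ∧
    (∀ N m : ℕ → ℕ, (∀ᶠ n in atTop, n ≤ N n) → (∀ᶠ n in atTop, m n ≤ N n) →
      (fun n : ℕ => (n : ℝ)) =O[atTop] (fun n => lawVar (hypergeometric (m n) n (N n))) →
      (fun n => dTV (hypergeometric (m n) n (N n)) (matchingTP (hypergeometric (m n) n (N n))))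
        =O[atTop] (fun n : ℕ => (n : ℝ) ^ (-(1 / 2) : ℝ)) ∧
      (fun n => dLoc (hypergeometric (m n) n (N n)) (matchingTP (hypergeometric (m n) n (N n))))
        =O[atTop] (fun n : ℕ => (n : ℝ)⁻¹)) := by
  refine ⟨?_, fun N m hn hm hv => ⟨isBigO_dTV_hypergeometric_matchingTP hn hm hv,
    isBigO_dLoc_hypergeometric_matchingTP hn hm hv⟩⟩
  rintro m n N hm0 hm hn0 hn ν μ v l rfl rfl rfl rfl
  have := isProbabilityMeasure_hypergeometric hm.le hn.le
  have hN : N ≠ 1 := by lia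
  have hv := lawVar_hypergeometric_pos hm0 hm hn0 hn
  refine ⟨lawVar_hypergeometric hm0 hm.le hn.le hN, regressionConstant_pos hm0 hm.le,
    fun hm2 => regressionConstant_lt_one hm2 hm, ℤ × ℤ, inferInstance, ballPair m n N,
    Prod.fst, Prod.snd, inferInstance, map_fst_ballPair,
    isExchangeablePair_ballPair hm0 hm.le hn.le, ?_, ae_birthDeathPair_snd_sub_fst_mem,
    dTV_hypergeometric_matchingTP_le_ballPair hm0 hm.le hn.le hv,
    dLoc_hypergeometric_matchingTP_le_ballPair hm0 hm.le hn.le hv,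
    variance_upProb_ballPair_le hm0 hm.le hn.le hN⟩
  rw [lawMean_hypergeometric hm0 hm.le hn.le]
  exact regressionCondition_ballPair hm0 hm.le hn.le

theorem theorem4p2 :
    (∀ m n N : ℕ, 0 < m → m < N → 0 < n → n < N →
      ∀ (ν : Measure ℤ) (μ v l : ℝ), ν = hypergeometric m n N → μ = lawMean ν → v = lawVar ν →
        l = (N : ℝ) / ((m : ℝ) * ((N : ℝ) - m + 1)) →
      v = (n : ℝ) * m * ((N : ℝ) - n) * ((N : ℝ) - m) / (((N : ℝ) - 1) * (N : ℝ) ^ 2) ∧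
      0 < l ∧ (2 ≤ m → l < 1) ∧
      ∃ (Ω : Type) (_ : MeasurableSpace Ω) (P : Measure Ω) (W W' : Ω → ℤ),
        IsProbabilityMeasure P ∧ P.map W = ν ∧
        IsExchangeablePair P W W' ∧
        RegressionCondition P W W' μ l (fun _ => 0) ∧
        (∀ᵐ ω ∂P, W' ω - W ω ∈ ({-1, 0, 1} : Set ℤ)) ∧
        dTV ν (translatedPoisson μ v)
          ≤ √(Var[upProb P W W'; P]) / (l * v) + 2 / v ∧
        dLoc ν (translatedPoisson μ v)
          ≤ 2 * √(qMax ν * Var[upProb P W W'; P]) / (l * v) + 2 / v ∧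
        Var[upProb P W W'; P]
          ≤ ((n : ℝ) * m * ((m : ℝ) + n) ^ 2 * ((N : ℝ) - n) * ((N : ℝ) - m)) /
            ((m : ℝ) ^ 2 * ((N : ℝ) - m + 1) ^ 2 * ((N : ℝ) - 1) * (N : ℝ) ^ 2)) ∧
    (∀ N m : ℕ → ℕ, (∀ᶠ n in atTop, n ≤ N n) → (∀ᶠ n in atTop, m n ≤ N n) →
      (fun n => (N n : ℝ)) =Θ[atTop] (fun n : ℕ => (n : ℝ)) →
      (fun n => (m n : ℝ)) =Θ[atTop] (fun n : ℕ => (n : ℝ)) →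
      (fun n => lawVar (hypergeometric (m n) n (N n))) =Θ[atTop] (fun n : ℕ => (n : ℝ)) →
      (fun n => dTV (hypergeometric (m n) n (N n)) (matchingTP (hypergeometric (m n) n (N n))))
        =O[atTop] (fun n : ℕ => (n : ℝ) ^ (-(1 / 2) : ℝ)) ∧
      (fun n => dLoc (hypergeometric (m n) n (N n)) (matchingTP (hypergeometric (m n) n (N n))))
        =O[atTop] (fun n : ℕ => (n : ℝ)⁻¹)) :=
  ⟨theorem4p2_general.1, fun N m hn hm _ _ hv => theorem4p2_general.2 N m hn hm hv.isBigO_symm⟩
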